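/- Let $\nu$ be a $\sigma$-finite measure on a measurable space $E$ and let $f_0,f_1$ be probability densities on $E$ with respect to $\nu$ with finite Kullback–Leibler divergence $D(f_1,f_0)=\int f_1\log(f_1/f_0)\,d\nu<\infty$. Let $0<\rho<1$, $0\le\pi_0<1$. The change point $\Gamma$ satisfies $\mathrm P(\Gamma=0)=\pi_0$ and $\mathrm P(\Gamma=k)=(1-\pi_0)\rho(1-\rho)^{k-1}$ for $k\ge1$; given $\Gamma=\ell$, the observations $X_1,X_2,\dots$ are independent, $X_n$ having density $f_0$ for $n<\ell$ and $f_1$ for $n\ge\ell$ (this conditional law is denoted $\mathrm P_\ell$, with expectation $\mathrm E_\ell$). Write $L=f_1/f_0$. For $B\in[0,1)$, the posterior probability $p_k$ with observation control at level $B$ evolves by $$p_{k+1}=\begin{cases}\tilde p_k,& p_k<B\quad(\text{observation skipped}),\\[2pt] \dfrac{\tilde p_kL(X_{k+1})}{\tilde p_kL(X_{k+1})+1-\tilde p_k},& p_k\ge B\quad(\text{observation taken}),\end{cases}\qquad \tilde p_k=p_k+(1-p_k)\rho .$$ Let $Z_k=\log\frac{p_k}{1-p_k}$ be the log-odds (with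 $Z_k=-\infty$ if $p_k=0$). For real $a,b$, the two-threshold algorithm $\gamma(a,b)$ uses $B=1/(1+e^{-b})$ (so that $p_k\geq B$ if and only if $Z_k\ge b$), starts at $p_0=\pi_0$ and stops at $\tau=\inf\{k\ge1:Z_k>a\}$. The Shiryaev procedure takes every observation ($B=0$), starts at $p_0=\pi_0$, and stops at $\nu_S=\inf\{k\ge1:Z_k>a\}$ for its own $Z_k$. Let $\mathrm{ADD}^s$ be the expectation under $\mathrm P_1$ (all observations i.i.d. with density $f_1$) of the time the process $Z_k$ of $\gamma(a,b)$, started at $Z_0=b$ and reset to $b$ each time it crosses $b$ from below, takes to exceed $a$. Equivalently, $\mathrm{ADD}^s=\mathrm E_1\big[\sum_{k=1}^N\Lambda_k\big]$, where $\Lambda_1,\Lambda_2,\dots$ are the lengths of the successive cycles, each starting at $b$ and ending when $Z$ either exceeds $a$ or crosses $b$ from below, and $N$ is the index of the first cycle that ends with $Z$ above $a$. **Theorem.** For fixed $b\in\mathbb R$ and $\rho$ (and fixed $f_0,f_1,\pi_0$), the quantities $\mathrm E[\tau-\Gamma\mid\tau\ge\Gamma]$, $\mathrm{ADD}^s$ and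 $\mathrm E[\nu_S-\Gamma\mid\nu_S\ge\Gamma]$ are finite for all large $a$, and as $a\to\infty$ $$\mathrm E[\tau-\Gamma\mid\tau\ge\Gamma]\le \mathrm{ADD}^s\,(1+o(1)),$$ $$\mathrm E[\tau-\Gamma\mid\tau\ge\Gamma]=\frac{a}{D(f_1,f_0)+|\log(1-\rho)|}\,(1+o(1)).$$ This is also the first-order delay of the Shiryaev procedure: $$\mathrm E[\nu_S-\Gamma\mid\nu_S\ge\Gamma]=\frac{a}{D(f_1,f_0)+|\log(1-\rho)|}\,(1+o(1)).$$ -/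

import Mathlib

open Filter Asymptotics MeasureTheory
open scoped ENNReal

namespace DataEfficientQCD

noncomputable section

/-- `f` is a probability density with respect to the reference measure `ν`. -/
structure IsProbDensity {E : Type*} [MeasurableSpace E] (ν : Measure E) (f : E → ℝ) : Prop where
  measurable : Measurable f
  nonneg : ∀ x, 0 ≤ f x
  lintegral_eq_one : ∫⁻ x, ENNReal.ofReal (f x) ∂ν = 1

/-- The distribution on `E` whose density with respect to `ν` is `f`. -/
def densityLaw {E : Type*} [MeasurableSpace E] (ν : Measure E) (f : E → ℝ) : Measure E :=
  ν.withDensity fun x => ENNReal.ofReal (f x)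

/-! Observation sequences are functions `X : ℕ → E`. The coordinate `X n` is the observation made
at time `n + 1`, so that the observations `X_1, X_2, …` are `X 0, X 1, …`. -/

/-- `P_ℓ`, the law of the observations when the change happens at time `ℓ`: they are independent,
with density `f₀` at the times before `ℓ`, and with density `f₁` at the times `ℓ, ℓ + 1, …`. -/
def changeLaw {E : Type*} [MeasurableSpace E] (ν : Measure E) (f₀ f₁ : E → ℝ) (l : ℕ) :
    Measure (ℕ → E) :=
  Measure.infinitePi fun n => if n + 1 < l then densityLaw ν f₀ else densityLaw ν f₁

/-- The prior probability that the change point equals `k`: mass `π₀` at `0`, and the rest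
geometric with parameter `ρ` on `1, 2, …`. -/
def prior (π₀ ρ : ℝ) (k : ℕ) : ℝ :=
  if k = 0 then π₀ else (1 - π₀) * (ρ * (1 - ρ) ^ (k - 1))

/-- The joint law `P` of the change point and of the observations: the change point has law
`prior π₀ ρ`, and given that it equals `k` the observations have law `P_k`. -/
def jointLaw {E : Type*} [MeasurableSpace E] (ν : Measure E) (f₀ f₁ : E → ℝ) (π₀ ρ : ℝ) :
    Measure (ℕ × (ℕ → E)) :=
  Measure.sum fun k =>
    ENNReal.ofReal (prior π₀ ρ k) • (Measure.dirac k).prod (changeLaw ν f₀ f₁ k)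

/-- The update of the posterior probability when the next observation is skipped. -/
def skipUpdate (ρ p : ℝ) : ℝ := p + (1 - p) * ρ

/-- The update of the posterior probability when the next observation is taken and has likelihood
ratio `L`. -/
def takeUpdate (ρ p L : ℝ) : ℝ :=
  skipUpdate ρ p * L / (skipUpdate ρ p * L + (1 - skipUpdate ρ p))

/-- One step of the observation control with threshold `B`: from the current posterior probability
`p`, skip the next observation `x` if `p < B`, and take it if `p ≥ B`. -/
def controlStep {E : Type*} (f₀ f₁ : E → ℝ) (ρ B p : ℝ) (x : E) : ℝ :=
  if p < B then skipUpdate ρ p else takeUpdate ρ p (f₁ x / f₀ x)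

/-- The posterior probability `p_k` of the change, started from `p_0`. -/
def posterior {E : Type*} (f₀ f₁ : E → ℝ) (ρ B p₀ : ℝ) (X : ℕ → E) : ℕ → ℝ
  | 0 => p₀
  | k + 1 => controlStep f₀ f₁ ρ B (posterior f₀ f₁ ρ B p₀ X k) (X k)

/-- The stopping time `inf {k ≥ 1 : p_k > A}`; it is `⊤` if there is no such `k`. -/
def stopTime {E : Type*} (f₀ f₁ : E → ℝ) (ρ A B p₀ : ℝ) (X : ℕ → E) : ℕ∞ :=
  ⨅ (k : ℕ) (_ : 1 ≤ k ∧ A < posterior f₀ f₁ ρ B p₀ X k), (k : ℕ∞)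

/-- The conditional average delay `E[τ - Γ | τ ≥ Γ]` of the stopping time `stopTime` with
thresholds `A`, `B`, started from `p_0 = π₀`, where `Γ` is the change point. -/
def condDelay {E : Type*} [MeasurableSpace E] (ν : Measure E) (f₀ f₁ : E → ℝ)
    (π₀ ρ A B : ℝ) : ℝ≥0∞ :=
  ∫⁻ ω, ((stopTime f₀ f₁ ρ A B π₀ ω.2 - (ω.1 : ℕ∞) : ℕ∞) : ℝ≥0∞)
    ∂(ProbabilityTheory.cond (jointLaw ν f₀ f₁ π₀ ρ)
      {ω : ℕ × (ℕ → E) | (ω.1 : ℕ∞) ≤ stopTime f₀ f₁ ρ A B π₀ ω.2})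

/-- `E[τ - Γ | τ ≥ Γ]` for the two-threshold algorithm `γ(a, b)`. On the log-odds scale
`Z = log (p / (1 - p))` the thresholds are `a` and `b`, that is, `A = 1 / (1 + e⁻ᵃ)` and
`B = 1 / (1 + e⁻ᵇ)` on the scale of `p`. -/
def twoThresholdDelay {E : Type*} [MeasurableSpace E] (ν : Measure E) (f₀ f₁ : E → ℝ)
    (π₀ ρ a b : ℝ) : ℝ≥0∞ :=
  condDelay ν f₀ f₁ π₀ ρ (Real.sigmoid a) (Real.sigmoid b)

/-- `E[τ - Γ | τ ≥ Γ]` for the Shiryaev procedure with threshold `a` on the log-odds scale. Here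
`B = 0`; as the posterior probability is never negative, every observation is taken. -/
def shiryaevDelay {E : Type*} [MeasurableSpace E] (ν : Measure E) (f₀ f₁ : E → ℝ)
    (π₀ ρ a : ℝ) : ℝ≥0∞ :=
  condDelay ν f₀ f₁ π₀ ρ (Real.sigmoid a) 0

/-- The posterior probability started at `p_0 = B` (log-odds `b`) and reset to `B` each time it
crosses `B` from below. -/
def resetPosterior {E : Type*} (f₀ f₁ : E → ℝ) (ρ B : ℝ) (X : ℕ → E) : ℕ → ℝ
  | 0 => B
  | k + 1 =>
    let p := resetPosterior f₀ f₁ ρ B X k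
    let q := controlStep f₀ f₁ ρ B p (X k)
    if p < B ∧ B ≤ q then B else q

/-- The time that the process `resetPosterior` takes to cross `A`. It is the sum
`Λ_1 + ⋯ + Λ_N` of the lengths of the cycles that start at `B` and end when the process either
exceeds `A` or crosses `B` from below; the `N`-th cycle is the first that ends above `A`.
(The value compared with `A` is the one before a possible reset.) -/
def resetTime {E : Type*} (f₀ f₁ : E → ℝ) (ρ A B : ℝ) (X : ℕ → E) : ℕ∞ :=
  ⨅ (k : ℕ) (_ : A < controlStep f₀ f₁ ρ B (resetPosterior f₀ f₁ ρ B X k) (X k)),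
    ((k + 1 : ℕ) : ℕ∞)

/-- `ADDˢ = E_1[Λ_1 + ⋯ + Λ_N]`, the average time from `b` to `a` when the change happens at time
`1` and the process is reset to `b` each time it crosses `b` from below. -/
def resetDelay {E : Type*} [MeasurableSpace E] (ν : Measure E) (f₀ f₁ : E → ℝ)
    (ρ a b : ℝ) : ℝ≥0∞ :=
  ∫⁻ X, ((resetTime f₀ f₁ ρ (Real.sigmoid a) (Real.sigmoid b) X : ℕ∞) : ℝ≥0∞)
    ∂(changeLaw ν f₀ f₁ 1)

/-- The Kullback-Leibler divergence `D(f₁, f₀) = ∫ f₁ log (f₁ / f₀) dν`, in `[0, ∞]`. -/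
def divergence {E : Type*} [MeasurableSpace E] (ν : Measure E) (f₁ f₀ : E → ℝ) : ℝ≥0∞ :=
  InformationTheory.klDiv (densityLaw ν f₁) (densityLaw ν f₀)

end

end DataEfficientQCD

/-! Pass to the odds `r = p / (1 - p)`. Skipping an observation maps `r` to `(r + ρ) / (1 - ρ)`, and
taking it multiplies this by the likelihood ratio `L`. The reset process obeys the same recursion
with a skip capped at the lower threshold `β`, so both kinds of process are treated at once through
`IsSkipRule`.

Tail bound. Under `f₁` the mean of `1 / L` is at most `1`, so a weighted version of `1 / (r + ρ)`
contracts in mean by `θ = √(1 - ρ)` at each step after the change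
(`lintegral_lyapunov_oddsStep_le`). By Markov's inequality, the odds `j` steps after the change are
at most `x` with probability at most `C x θ ^ j`, uniformly in the change point
(`changeLaw_oddsProcess_le_le`).

Growth. By Borel–Cantelli the odds tend to infinity, so almost surely only finitely many
observations are skipped. Then `log r` stays close to the random walk with increments `log L - log
(1 - ρ)`, and the strong law gives `log (r n) / n → μ = D + |log (1 - ρ)|`
(`tendsto_log_oddsStep_div`).

Mean delay. The passage time over `exp a` is therefore almost surely equivalent to `a / μ`, and the
tail bound upgrades this to convergence of means (`tendsto_lintegral_firstPassage_sub`).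
Conditioning on `τ ≥ Γ` is harmless, as the probability of this event tends to `1`. All three delays
are equivalent to `a / μ`, so the inequality with `ADDˢ` follows by comparing limits. -/

open scoped Topology

namespace DataEfficientQCD

/-! ### First passage times of a deterministic sequence. -/

/-- The first time `k ≥ 1` at which the sequence `r` exceeds `y`. -/
noncomputable def firstPassage (r : ℕ → ℝ) (y : ℝ) : ℕ∞ :=
  ⨅ (k : ℕ) (_ : 1 ≤ k ∧ y < r k), (k : ℕ∞)

theorem natCast_lt_firstPassage_iff {r : ℕ → ℝ} {y : ℝ} {n : ℕ} :
    (n : ℕ∞) < firstPassage r y ↔ ∀ k, 1 ≤ k → k ≤ n → r k ≤ y := by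
  constructor
  · intro h k hk hkn
    by_contra! hy
    have : firstPassage r y ≤ k := iInf₂_le k ⟨hk, hy⟩
    exact absurd (h.trans_le this) (by simpa using hkn)
  · intro h
    have : ((n + 1 : ℕ) : ℕ∞) ≤ firstPassage r y := by
      refine le_iInf₂ fun k hk => ?_
      by_contra! hlt
      have : k ≤ n := by
        have : k < n + 1 := by exact_mod_cast hlt
        omega
      exact absurd (h k hk.1 this) (not_le.2 hk.2)
    exact lt_of_lt_of_le (by exact_mod_cast Nat.lt_succ_self n) this

theorem firstPassage_eq_find {r : ℕ → ℝ} {y : ℝ} (h : ∃ k, 1 ≤ k ∧ y < r k) :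
    ∃ T : ℕ, firstPassage r y = T ∧ 1 ≤ T ∧ y < r T ∧ ∀ k, 1 ≤ k → k < T → r k ≤ y := by
  classical
  refine ⟨Nat.find h, le_antisymm (iInf₂_le (Nat.find h) (Nat.find_spec h)) ?_, (Nat.find_spec h).1,
    (Nat.find_spec h).2, fun k hk hkT => ?_⟩
  · refine le_iInf₂ fun k hk => ?_
    exact_mod_cast Nat.find_min' h hk
  · by_contra! hy
    exact Nat.find_min h hkT ⟨hk, hy⟩

theorem tendsto_atTop_of_tendsto_log_div {r : ℕ → ℝ} {μ : ℝ} (hμ : 0 < μ) (hr : ∀ n, 0 ≤ r n)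
    (h : Tendsto (fun n : ℕ => Real.log (r n) / n) atTop (𝓝 μ)) : Tendsto r atTop atTop := by
  have hlog : Tendsto (fun n : ℕ => Real.log (r n)) atTop atTop := by
    have := h.pos_mul_atTop hμ tendsto_natCast_atTop_atTop
    refine this.congr' ?_
    filter_upwards [eventually_gt_atTop 0] with n hn
    have : (n : ℝ) ≠ 0 := by positivity
    field_simp
  refine tendsto_atTop_mono' _ ?_ hlog
  exact Eventually.of_forall fun n => Real.log_le_self (hr n)

/-- If `log (r n)` grows like `μ n`, then `r` takes time about `a / μ` to exceed `exp a`. -/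
theorem tendsto_firstPassage_div {r : ℕ → ℝ} {μ : ℝ} (hμ : 0 < μ) (hr : ∀ n, 0 ≤ r n)
    (h : Tendsto (fun n : ℕ => Real.log (r n) / n) atTop (𝓝 μ)) :
    Tendsto (fun a : ℝ => (firstPassage r (Real.exp a) : ℝ≥0∞) / ENNReal.ofReal a) atTop
      (𝓝 (ENNReal.ofReal μ⁻¹)) := by
  have hrt := tendsto_atTop_of_tendsto_log_div hμ hr h
  have hex : ∀ a : ℝ, ∃ T : ℕ, firstPassage r (Real.exp a) = T ∧ 1 ≤ T ∧ Real.exp a < r T ∧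
      ∀ k, 1 ≤ k → k < T → r k ≤ Real.exp a := fun a => by
    obtain ⟨k, hk⟩ := ((eventually_ge_atTop 1).and (hrt.eventually_gt_atTop (Real.exp a))).exists
    exact firstPassage_eq_find ⟨k, hk⟩
  choose T hT hT1 hTa hTlt using hex
  have hTtop : Tendsto T atTop atTop := by
    refine tendsto_atTop.2 fun n => ?_
    have : ∀ᶠ a : ℝ in atTop, ∀ k ∈ Finset.range n, r k ≤ Real.exp a :=
      (Finset.eventually_all _).2 fun k _ => Real.tendsto_exp_atTop.eventually_ge_atTop _
    filter_upwards [this] with a ha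
    by_contra! hlt
    exact absurd (ha _ (Finset.mem_range.2 hlt)) (not_le.2 (hTa a))
  have hup : Tendsto (fun a => Real.log (r (T a)) / T a) atTop (𝓝 μ) := h.comp hTtop
  have hlow : Tendsto (fun a => Real.log (r (T a - 1)) / T a) atTop (𝓝 μ) := by
    have h1 : Tendsto (fun n : ℕ => Real.log (r n) / (n + 1 : ℕ)) atTop (𝓝 μ) := by
      have := h.mul (tendsto_natCast_div_add_atTop (1 : ℝ))
      rw [mul_one] at this
      refine this.congr' ?_
      filter_upwards [eventually_gt_atTop 0] with n hn
      have : (n : ℝ) ≠ 0 := by positivity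
      push_cast
      field_simp
    have h2 := h1.comp ((tendsto_sub_atTop_nat 1).comp hTtop)
    refine h2.congr fun a => ?_
    simp only [Function.comp]
    rw [Nat.sub_add_cancel (hT1 a)]
  -- At the passage time `a` lies between `log (r (T a - 1))` and `log (r (T a))`.
  have hmid : Tendsto (fun a => a / T a) atTop (𝓝 μ) := by
    refine tendsto_of_tendsto_of_tendsto_of_le_of_le' hlow hup ?_ ?_
    · filter_upwards [hTtop.eventually_ge_atTop 2, eventually_ge_atTop 0] with a ha ha0
      gcongr
      -- If the odds vanish, the convention `log 0 = 0` still gives the bound because `a ≥ 0`.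
      rcases (hr (T a - 1)).eq_or_lt with h0 | h0
      · simpa [← h0] using ha0
      · exact (Real.log_le_iff_le_exp h0).2 (hTlt a _ (by omega) (by omega))
    · filter_upwards with a
      gcongr
      exact ((Real.lt_log_iff_exp_lt ((Real.exp_pos a).trans (hTa a))).2 (hTa a)).le
  have hinv := hmid.inv₀ hμ.ne'
  refine (ENNReal.tendsto_ofReal hinv).congr' ?_
  filter_upwards [eventually_gt_atTop 0] with a ha
  rw [hT, inv_div, ENNReal.ofReal_div_of_pos ha]
  simp

/-! ### From pathwise growth to mean delays. -/

section Expectation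

/-- Tail-sum formula: it reduces measurability and integration of a random time to the events that
it exceeds `j`. -/
theorem toENNReal_eq_tsum (n : ℕ∞) :
    (n : ℝ≥0∞) = ∑' j : ℕ, if (j : ℕ∞) < n then (1 : ℝ≥0∞) else 0 := by
  induction n with
  | top => simp
  | coe n =>
    rw [tsum_eq_sum (s := Finset.range n)]
    · rw [Finset.sum_congr rfl (g := fun _ => (1 : ℝ≥0∞))]
      · simp
      · intro j hj
        have : (j : ℕ∞) < n := by exact_mod_cast Finset.mem_range.1 hj
        simp [this]
    · intro j hj
      have : ¬ (j : ℕ∞) < n := by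
        have := Finset.mem_range.not.1 hj
        exact_mod_cast this
      simp [this]

variable {Ω : Type*} [MeasurableSpace Ω] {P : Measure Ω} {R : Ω → ℕ → ℝ} {Γ : Ω → ℕ}

theorem measurableSet_lt_firstPassage (hR : ∀ n, Measurable fun ω => R ω n) (hΓ : Measurable Γ)
    (y : ℝ) (j : ℕ) : MeasurableSet {ω | ((Γ ω + j : ℕ) : ℕ∞) < firstPassage (R ω) y} := by
  simp_rw [natCast_lt_firstPassage_iff]
  have : {ω | ∀ k, 1 ≤ k → k ≤ Γ ω + j → R ω k ≤ y} =
      ⋂ (k : ℕ) (_ : 1 ≤ k), ({ω | k ≤ Γ ω + j}ᶜ ∪ {ω | R ω k ≤ y}) := by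
    ext ω
    simp [imp_iff_not_or]
  rw [this]
  refine MeasurableSet.iInter fun k => MeasurableSet.iInter fun _ => ?_
  exact (measurableSet_le measurable_const (hΓ.add_const j)).compl.union
    (measurableSet_le (hR k) measurable_const)

theorem natCast_lt_firstPassage_sub_iff {r : ℕ → ℝ} {y : ℝ} {g j : ℕ} :
    (j : ℕ∞) < firstPassage r y - g ↔ ((g + j : ℕ) : ℕ∞) < firstPassage r y := by
  rw [lt_tsub_iff_left]
  norm_cast

theorem measurable_delay (hR : ∀ n, Measurable fun ω => R ω n) (hΓ : Measurable Γ) (y : ℝ) :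
    Measurable fun ω => ((firstPassage (R ω) y - Γ ω : ℕ∞) : ℝ≥0∞) := by
  simp_rw [toENNReal_eq_tsum, natCast_lt_firstPassage_sub_iff]
  exact Measurable.tsum fun j =>
    Measurable.ite (measurableSet_lt_firstPassage hR hΓ y j) measurable_const measurable_const

theorem measurableSet_le_firstPassage (hR : ∀ n, Measurable fun ω => R ω n) (hΓ : Measurable Γ)
    (y : ℝ) : MeasurableSet {ω | (Γ ω : ℕ∞) ≤ firstPassage (R ω) y} := by
  have : {ω | (Γ ω : ℕ∞) ≤ firstPassage (R ω) y} =
      {ω | Γ ω = 0} ∪ {ω | (((Γ ω - 1) + 0 : ℕ) : ℕ∞) < firstPassage (R ω) y} := by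
    ext ω
    rcases Nat.eq_zero_or_pos (Γ ω) with h | h
    · simp [h]
    · obtain ⟨m, hm⟩ : ∃ m, Γ ω = m + 1 := ⟨Γ ω - 1, by omega⟩
      simp only [Set.mem_ofPred_eq, Set.mem_union, hm, Nat.add_sub_cancel, add_zero]
      simp [ENat.add_one_le_iff]
  rw [this]
  exact (hΓ (measurableSet_singleton 0)).union
    (measurableSet_lt_firstPassage hR ((measurable_of_countable fun n => n - 1).comp hΓ) y 0)

/-- The mean excess over `M` is the sum of the tail probabilities from `M` on, dominated by a
geometric series. As `M ≥ 1`, tail bounds from `j = 1` suffice. -/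
theorem lintegral_sub_natCast_le {N : Ω → ℕ∞}
    (hN : ∀ j : ℕ, MeasurableSet {ω | (j : ℕ∞) < N ω}) (M : ℕ) {K θ : ℝ} (hK : 0 ≤ K) (hθ : 0 ≤ θ)
    (hθ1 : θ < 1) (hM : 1 ≤ M)
    (h : ∀ j : ℕ, 1 ≤ j → P {ω | (j : ℕ∞) < N ω} ≤ ENNReal.ofReal (K * θ ^ j)) :
    ∫⁻ ω, ((N ω - M : ℕ∞) : ℝ≥0∞) ∂P ≤ ENNReal.ofReal (K * θ ^ M / (1 - θ)) := by
  have key : ∀ (j : ℕ) ω, (j : ℕ∞) < N ω - M ↔ ((M + j : ℕ) : ℕ∞) < N ω := fun j ω => by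
    rw [lt_tsub_iff_left]; norm_cast
  simp_rw [toENNReal_eq_tsum, key]
  rw [lintegral_tsum fun j => (Measurable.ite (hN _) measurable_const measurable_const).aemeasurable]
  have hs : HasSum (fun j : ℕ => K * θ ^ (M + j)) (K * θ ^ M / (1 - θ)) := by
    have := (hasSum_geometric_of_lt_one hθ hθ1).mul_left (K * θ ^ M)
    simpa [pow_add, mul_assoc, div_eq_mul_inv] using this
  rw [← hs.tsum_eq, ENNReal.ofReal_tsum_of_nonneg (fun j => by positivity) hs.summable]
  refine ENNReal.tsum_le_tsum fun j => ?_
  have : ∫⁻ ω, (if ((M + j : ℕ) : ℕ∞) < N ω then (1 : ℝ≥0∞) else 0) ∂P =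
      P {ω | ((M + j : ℕ) : ℕ∞) < N ω} := by
    rw [← lintegral_indicator_one (hN _)]
    exact lintegral_congr fun ω => by simp [Set.indicator_apply]
  rw [this]
  exact h _ (by omega)

/-- Asymptotics of the mean delay of a first passage: almost sure logarithmic growth of the process
at rate `μ` together with exponentially small probabilities of being small. -/
theorem tendsto_lintegral_firstPassage_sub [IsProbabilityMeasure P]
    (hR : ∀ n, Measurable fun ω => R ω n) (hR0 : ∀ ω n, 0 ≤ R ω n) (hΓ : Measurable Γ)
    {μ : ℝ} (hμ : 0 < μ)
    (hlog : ∀ᵐ ω ∂P, Tendsto (fun n : ℕ => Real.log (R ω n) / n) atTop (𝓝 μ))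
    {C θ : ℝ} (hC : 0 ≤ C) (hθ : 0 < θ) (hθ1 : θ < 1)
    (htail : ∀ x, 1 ≤ x → ∀ j : ℕ, 1 ≤ j →
      P {ω | R ω (Γ ω + j) ≤ x} ≤ ENNReal.ofReal (C * x * θ ^ j)) :
    Tendsto (fun a : ℝ => (∫⁻ ω, ((firstPassage (R ω) (Real.exp a) - Γ ω : ℕ∞) : ℝ≥0∞) ∂P) /
      ENNReal.ofReal a) atTop (𝓝 (ENNReal.ofReal μ⁻¹)) := by
  have hlθ : 0 < -Real.log θ := by linarith [Real.log_neg hθ hθ1]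
  -- The delay is truncated at about `κ a`. The bound `κ ≥ μ⁻¹` keeps the truncation from affecting
  -- the limit; `κ ≥ (-log θ)⁻¹` makes `exp a * θ ^ M a ≤ 1`, so that the mean excess stays bounded.
  set κ : ℝ := max μ⁻¹ (-Real.log θ)⁻¹ with hκ
  have hκ0 : 0 < κ := lt_max_of_lt_left (by positivity)
  set M : ℝ → ℕ := fun a => ⌈κ * a⌉₊ + 1 with hMdef
  set N : ℝ → Ω → ℕ∞ := fun a ω => firstPassage (R ω) (Real.exp a) - Γ ω with hNdef
  have hNm : ∀ a, ∀ j : ℕ, MeasurableSet {ω | (j : ℕ∞) < N a ω} := fun a j => by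
    simp_rw [hNdef, natCast_lt_firstPassage_sub_iff]
    exact measurableSet_lt_firstPassage hR hΓ _ j
  have hNmeas : ∀ a, Measurable fun ω => (N a ω : ℝ≥0∞) := fun a => measurable_delay hR hΓ _
  have hMle : ∀ a, κ * a ≤ M a := fun a => by
    have := Nat.le_ceil (κ * a)
    simp only [hMdef]; push_cast; linarith
  -- the truncated delay
  have h1 : Tendsto (fun a : ℝ => ∫⁻ ω, min ((N a ω : ℝ≥0∞) / ENNReal.ofReal a)
      ((M a : ℝ≥0∞) / ENNReal.ofReal a) ∂P) atTop (𝓝 (∫⁻ _, ENNReal.ofReal μ⁻¹ ∂P)) := by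
    refine tendsto_lintegral_filter_of_dominated_convergence (fun _ => ENNReal.ofReal (κ + 2))
      ?_ ?_ (by simp) ?_
    · exact Eventually.of_forall fun a => ((hNmeas a).div_const _).min measurable_const
    · filter_upwards [eventually_ge_atTop 1] with a ha
      refine Eventually.of_forall fun ω => (min_le_right _ _).trans ?_
      have ha0 : 0 < a := by linarith
      rw [ENNReal.div_le_iff (by simpa using ha0) (by simp), ← ENNReal.ofReal_mul (by positivity),
        ← ENNReal.ofReal_natCast]
      refine ENNReal.ofReal_le_ofReal ?_
      have := (Nat.ceil_lt_add_one (show 0 ≤ κ * a by positivity)).le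
      simp only [hMdef]; push_cast; nlinarith
    · filter_upwards [hlog] with ω hω
      have hf := tendsto_firstPassage_div hμ (hR0 ω) hω
      have hg : Tendsto (fun a : ℝ => ((Γ ω : ℕ∞) : ℝ≥0∞) / ENNReal.ofReal a) atTop (𝓝 0) := by
        have := ENNReal.Tendsto.div (tendsto_const_nhds (x := ((Γ ω : ℕ∞) : ℝ≥0∞)) (f := atTop))
          (Or.inr (by simp)) (ENNReal.tendsto_ofReal_atTop) (Or.inr (by simp))
        simpa using this
      have hN : Tendsto (fun a => (N a ω : ℝ≥0∞) / ENNReal.ofReal a) atTop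
          (𝓝 (ENNReal.ofReal μ⁻¹)) := by
        have := ENNReal.Tendsto.sub hf hg (Or.inl (by simp))
        rw [tsub_zero] at this
        refine this.congr' ?_
        filter_upwards [eventually_gt_atTop 0] with a ha
        simp only [hNdef]
        rw [ENat.toENNReal_sub, ENNReal.div_eq_inv_mul, ENNReal.div_eq_inv_mul,
          ENNReal.div_eq_inv_mul, ENNReal.mul_sub (by simp [ha])]
      -- Since `M a / a ≥ μ⁻¹`, the truncated quotient lies between `min (N a / a) μ⁻¹` and `N a /
      -- a`.
      refine tendsto_of_tendsto_of_tendsto_of_le_of_le'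
        (g := fun a => min ((N a ω : ℝ≥0∞) / ENNReal.ofReal a) (ENNReal.ofReal μ⁻¹)) ?_ hN ?_ ?_
      · simpa using hN.min (tendsto_const_nhds (x := ENNReal.ofReal μ⁻¹))
      · filter_upwards [eventually_gt_atTop 0] with a ha
        refine min_le_min le_rfl ?_
        rw [ENNReal.le_div_iff_mul_le (by simp [ha]) (by simp), ← ENNReal.ofReal_mul (by positivity),
          ← ENNReal.ofReal_natCast]
        refine ENNReal.ofReal_le_ofReal (le_trans ?_ (hMle a))
        gcongr
        exact le_max_left _ _
      · exact Eventually.of_forall fun a => min_le_left _ _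
  -- the excess
  have h2 : Tendsto (fun a : ℝ => (∫⁻ ω, ((N a ω - M a : ℕ∞) : ℝ≥0∞) ∂P) / ENNReal.ofReal a) atTop
      (𝓝 0) := by
    have hlim : Tendsto (fun a : ℝ => ENNReal.ofReal (C / (1 - θ)) / ENNReal.ofReal a) atTop
        (𝓝 0) := by
      have := ENNReal.Tendsto.div
        (tendsto_const_nhds (x := ENNReal.ofReal (C / (1 - θ))) (f := atTop))
        (Or.inr (by simp)) (ENNReal.tendsto_ofReal_atTop) (Or.inr (by simp))
      simpa using this
    refine tendsto_of_tendsto_of_tendsto_of_le_of_le' tendsto_const_nhds hlim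
      (Eventually.of_forall fun a => zero_le) ?_
    filter_upwards [eventually_ge_atTop 0] with a ha
    refine ENNReal.div_le_div_right ?_ _
    refine (lintegral_sub_natCast_le (hNm a) (M a) (K := C * Real.exp a) (by positivity) hθ.le hθ1
      (by simp [hMdef]) fun j hj => ?_).trans ?_
    · refine (measure_mono fun ω hω => ?_).trans (htail (Real.exp a) (Real.one_le_exp ha) j hj)
      have := natCast_lt_firstPassage_sub_iff.1 hω
      exact natCast_lt_firstPassage_iff.1 this _ (by omega) le_rfl
    · refine ENNReal.ofReal_le_ofReal ?_
      have h1θ : 0 < 1 - θ := by linarith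
      have : Real.exp a * θ ^ M a ≤ 1 := by
        rw [← Real.exp_log hθ, ← Real.exp_nat_mul, ← Real.exp_add]
        refine Real.exp_le_one_iff.2 ?_
        have hk : 1 ≤ κ * (-Real.log θ) := by
          have := mul_le_mul_of_nonneg_right (le_max_right μ⁻¹ (-Real.log θ)⁻¹) hlθ.le
          rwa [inv_mul_cancel₀ hlθ.ne'] at this
        have := mul_le_mul_of_nonneg_right (hMle a) hlθ.le
        nlinarith
      rw [mul_assoc]
      gcongr
      nlinarith
  -- The two limits recombine through `N = min N M + (N - M)`.
  have h3 := h1.add h2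
  simp only [lintegral_const, measure_univ, mul_one, add_zero] at h3
  refine h3.congr' ?_
  filter_upwards [eventually_gt_atTop 0] with a ha
  have hmin : ∀ ω, min ((N a ω : ℝ≥0∞) / ENNReal.ofReal a) ((M a : ℝ≥0∞) / ENNReal.ofReal a) =
      min (N a ω : ℝ≥0∞) (M a) / ENNReal.ofReal a := fun ω =>
    (Monotone.map_min (f := fun x : ℝ≥0∞ => x / ENNReal.ofReal a)
      fun x y hxy => ENNReal.div_le_div_right hxy _).symm
  simp_rw [hmin, div_eq_mul_inv]
  rw [lintegral_mul_const _ ((hNmeas a).min measurable_const), ← add_mul,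
    ← lintegral_add_left ((hNmeas a).min measurable_const)]
  congr 1
  refine lintegral_congr fun ω => ?_
  have hsub : ((N a ω - M a : ℕ∞) : ℝ≥0∞) = (N a ω : ℝ≥0∞) - (M a : ℝ≥0∞) := by
    rw [ENat.toENNReal_sub (N a ω), ENat.toENNReal_coe]
  change _ = (N a ω : ℝ≥0∞)
  rw [hsub, add_comm]
  exact tsub_add_min

end Expectation

/-! ### The odds recursion and its growth along a single path. -/

/-- One step of the odds process: below the level `β` the observation is skipped and the odds are
updated by `g`; otherwise the observation, with likelihood ratio `L`, is taken. -/
noncomputable def oddsStep (g : ℝ → ℝ) (ρ β r L : ℝ) : ℝ :=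
  if r < β then g r else (r + ρ) / (1 - ρ) * L

/-- The skipping rules of the posterior odds and of their version with resets at `β`: the odds do
not decrease, and are updated as usual as long as they remain below `β`. -/
structure IsSkipRule (ρ β : ℝ) (g : ℝ → ℝ) : Prop where
  measurable : Measurable g
  le_self : ∀ r, 0 ≤ r → r < β → r ≤ g r
  le_skip : ∀ r, g r ≤ (r + ρ) / (1 - ρ)
  eq_skip : ∀ r, 0 ≤ r → g r < β → g r = (r + ρ) / (1 - ρ)

section Growth

variable {g : ℝ → ℝ} {ρ β D : ℝ} {r L : ℕ → ℝ}

theorem summable_exp_neg_of_tendsto_div {W : ℕ → ℝ} {μ : ℝ} (hμ : 0 < μ)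
    (hW : Tendsto (fun n : ℕ => W n / n) atTop (𝓝 μ)) : Summable fun n => Real.exp (-W n) := by
  have hs : Summable fun n : ℕ => Real.exp (n * -(μ / 2)) :=
    Real.summable_exp_nat_mul_iff.2 (by linarith)
  refine summable_of_isBigO_nat hs (IsBigO.of_bound 1 ?_)
  filter_upwards [hW.eventually_const_lt (show μ / 2 < μ by linarith), eventually_gt_atTop 0]
    with n hn hn0
  have : (0 : ℝ) < n := by exact_mod_cast hn0
  rw [lt_div_iff₀ this] at hn
  rw [Real.norm_of_nonneg (Real.exp_pos _).le, Real.norm_of_nonneg (Real.exp_pos _).le, one_mul]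
  exact Real.exp_le_exp.2 (by linarith)

/-- Variation of constants: in one step `exp (-W n) * r n` increases by at most `ρ * exp (-W n)` if
the observation is taken. After a skip the new odds are at most `(β + ρ) / (1 - ρ)` outright, which
costs a multiple of `exp (-W (n + 1))`. -/
theorem oddsStep_le_exp_mul (hg : IsSkipRule ρ β g) (hρ : 0 < ρ) (hρ1 : ρ < 1) (hβ : 0 ≤ β)
    (hL : ∀ n, 0 < L n) (hr : ∀ n, 0 ≤ r n) (hstep : ∀ n, r (n + 1) = oddsStep g ρ β (r n) (L n))
    {W : ℕ → ℝ} (hW0 : W 0 = 0)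
    (hW : ∀ n, W (n + 1) = W n + (Real.log (L n) - Real.log (1 - ρ))) (n : ℕ) :
    r n ≤ Real.exp (W n) * (r 0 + (β + ρ) / (1 - ρ) *
      ∑ j ∈ Finset.range n, (Real.exp (-W j) + Real.exp (-W (j + 1)))) := by
  have h1 : 0 < 1 - ρ := by linarith
  induction n with
  | zero => simp [hW0]
  | succ n ih =>
    set A := r 0 + (β + ρ) / (1 - ρ) *
      ∑ j ∈ Finset.range n, (Real.exp (-W j) + Real.exp (-W (j + 1))) with hA
    have hA0 : 0 ≤ A := by have := hr 0; positivity
    have hA1 : r 0 + (β + ρ) / (1 - ρ) *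
        ∑ j ∈ Finset.range (n + 1), (Real.exp (-W j) + Real.exp (-W (j + 1))) =
        A + (β + ρ) / (1 - ρ) * (Real.exp (-W n) + Real.exp (-W (n + 1))) := by
      rw [Finset.sum_range_succ, hA]; ring
    rw [hA1, hstep, oddsStep]
    have hC : ρ ≤ (β + ρ) / (1 - ρ) := by
      rw [le_div_iff₀ h1]; nlinarith
    set C := (β + ρ) / (1 - ρ)
    have hC0 : 0 < C := hρ.trans_le hC
    have e1 : Real.exp (W (n + 1)) * Real.exp (-W (n + 1)) = 1 := by rw [← Real.exp_add]; simp
    have e2 : Real.exp (W (n + 1)) = Real.exp (W n) * (L n / (1 - ρ)) := by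
      rw [hW, Real.exp_add, Real.exp_sub, Real.exp_log (hL n), Real.exp_log h1]
    have e3 : Real.exp (W n) * Real.exp (-W n) = 1 := by rw [← Real.exp_add]; simp
    split_ifs with h
    · have : g (r n) ≤ C := (hg.le_skip _).trans (by simp only [C]; gcongr)
      have h2 : 0 ≤ Real.exp (W (n + 1)) * (A + C * Real.exp (-W n)) := by positivity
      calc g (r n) ≤ C * (Real.exp (W (n + 1)) * Real.exp (-W (n + 1))) := by rw [e1]; linarith
        _ ≤ _ := by linarith
    · have hLn := hL n
      calc (r n + ρ) / (1 - ρ) * L n = (r n + ρ) * (L n / (1 - ρ)) := by ring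
        _ ≤ (Real.exp (W n) * A + C * (Real.exp (W n) * Real.exp (-W n))) * (L n / (1 - ρ)) := by
          rw [e3]
          gcongr
          linarith
        _ = Real.exp (W (n + 1)) * (A + C * Real.exp (-W n)) := by rw [e2]; ring
        _ ≤ _ := by
          gcongr
          have := Real.exp_pos (-W (n + 1))
          linarith

/-- From time `k` on nothing is skipped, and dropping the `+ ρ` from each update leaves exactly the
increments of `W`. -/
theorem add_sub_le_log_oddsStep (hρ : 0 < ρ) (hρ1 : ρ < 1) (hL : ∀ n, 0 < L n)
    (hstep : ∀ n, r (n + 1) = oddsStep g ρ β (r n) (L n))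
    {W : ℕ → ℝ} (hW : ∀ n, W (n + 1) = W n + (Real.log (L n) - Real.log (1 - ρ))) {k : ℕ}
    (hk : ∀ n, k ≤ n → 0 < r n ∧ β ≤ r n) {n : ℕ} (hn : k ≤ n) :
    Real.log (r k) - W k + W n ≤ Real.log (r n) := by
  have h1 : 0 < 1 - ρ := by linarith
  induction n, hn using Nat.le_induction with
  | base => simp
  | succ n hn ih =>
    obtain ⟨h0, hβ⟩ := hk n hn
    rw [hstep, oddsStep, if_neg (not_lt.2 hβ), Real.log_mul (by positivity) (hL n).ne',
      Real.log_div (by positivity) h1.ne', hW]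
    have : Real.log (r n) ≤ Real.log (r n + ρ) := Real.log_le_log h0 (by linarith)
    linarith

/-- The odds process grows logarithmically like the random walk of the log-likelihood ratios with
the additional drift `-log (1 - ρ)`. -/
theorem tendsto_log_oddsStep_div (hg : IsSkipRule ρ β g) (hρ : 0 < ρ) (hρ1 : ρ < 1) (hβ : 0 ≤ β)
    (hD : 0 ≤ D) (hL : ∀ n, 0 < L n) (hr : ∀ n, 0 ≤ r n)
    (hstep : ∀ n, r (n + 1) = oddsStep g ρ β (r n) (L n)) (hrt : Tendsto r atTop atTop)
    (havg : Tendsto (fun n : ℕ => (∑ i ∈ Finset.range n, Real.log (L i)) / n) atTop (𝓝 D)) :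
    Tendsto (fun n : ℕ => Real.log (r n) / n) atTop (𝓝 (D - Real.log (1 - ρ))) := by
  have h1 : 0 < 1 - ρ := by linarith
  have hlog : Real.log (1 - ρ) < 0 := Real.log_neg h1 (by linarith)
  set μ := D - Real.log (1 - ρ) with hμ
  have hμ0 : 0 < μ := by linarith
  set W : ℕ → ℝ := fun n => ∑ i ∈ Finset.range n, (Real.log (L i) - Real.log (1 - ρ)) with hWdef
  have hW0 : W 0 = 0 := by simp [hWdef]
  have hW : ∀ n, W (n + 1) = W n + (Real.log (L n) - Real.log (1 - ρ)) := fun n => by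
    simp only [hWdef, Finset.sum_range_succ]
  have hWt : Tendsto (fun n : ℕ => W n / n) atTop (𝓝 μ) := by
    refine (havg.sub_const (Real.log (1 - ρ))).congr' ?_
    filter_upwards [eventually_gt_atTop 0] with n hn
    have : (n : ℝ) ≠ 0 := by positivity
    simp only [hWdef, Finset.sum_sub_distrib, Finset.sum_const, Finset.card_range, nsmul_eq_mul]
    field_simp
  have hsum := summable_exp_neg_of_tendsto_div hμ0 hWt
  set C := (β + ρ) / (1 - ρ) with hC
  have hC0 : 0 ≤ C := by positivity
  set S := ∑' n, Real.exp (-W n)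
  set K := r 0 + C * (2 * S) + 1 with hK
  have hS0 : 0 ≤ S := tsum_nonneg fun n => (Real.exp_pos _).le
  have hK0 : 0 < K := by have := hr 0; positivity
  have hup : ∀ n, r n ≤ Real.exp (W n) * K := fun n => by
    refine (oddsStep_le_exp_mul hg hρ hρ1 hβ hL hr hstep hW0 hW n).trans ?_
    gcongr
    have e1 : ∑ j ∈ Finset.range n, Real.exp (-W j) ≤ S :=
      hsum.sum_le_tsum _ fun n _ => (Real.exp_pos _).le
    have e2 : ∑ j ∈ Finset.range n, Real.exp (-W (j + 1)) ≤ S := by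
      have := hsum.sum_le_tsum (Finset.range (n + 1)) fun n _ => (Real.exp_pos _).le
      rw [Finset.sum_range_succ'] at this
      have h0 := Real.exp_pos (-W 0)
      linarith
    rw [Finset.sum_add_distrib, hK]
    nlinarith
  -- After time `k` the odds are positive and never again below the skipping level.
  obtain ⟨k, hk⟩ := eventually_atTop.1
    ((hrt.eventually_gt_atTop 0).and (hrt.eventually_ge_atTop β))
  have aux : ∀ c : ℝ, Tendsto (fun n : ℕ => (c + W n) / n) atTop (𝓝 μ) := fun c => by
    have := (tendsto_const_div_atTop_nhds_zero_nat c).add hWt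
    simpa [add_div] using this
  refine tendsto_of_tendsto_of_tendsto_of_le_of_le' (aux (Real.log (r k) - W k)) (aux (Real.log K))
    ?_ ?_
  · filter_upwards [eventually_ge_atTop k] with n hn
    gcongr
    exact add_sub_le_log_oddsStep hρ hρ1 hL hstep hW hk hn
  · filter_upwards [eventually_ge_atTop k] with n hn
    gcongr
    have := Real.log_le_log (hk n hn).1 (hup n)
    rw [Real.log_mul (Real.exp_pos _).ne' hK0.ne', Real.log_exp] at this
    linarith

theorem tendsto_div_of_tendsto_add_div {f : ℕ → ℝ} {μ : ℝ} (m : ℕ)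
    (h : Tendsto (fun n : ℕ => f (m + n) / n) atTop (𝓝 μ)) :
    Tendsto (fun n : ℕ => f n / n) atTop (𝓝 μ) := by
  rw [← tendsto_add_atTop_iff_nat m]
  have := h.mul (tendsto_natCast_div_add_atTop (m : ℝ))
  rw [mul_one] at this
  refine this.congr' ?_
  filter_upwards [eventually_gt_atTop 0] with n hn
  have : (n : ℝ) ≠ 0 := by positivity
  have : (n : ℝ) + m ≠ 0 := by positivity
  rw [add_comm n m]
  push_cast
  rw [add_comm (m : ℝ)]
  field_simp

end Growth

/-! ### Processes driven by independent observations. -/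

section Driven

variable {E : Type*} [MeasurableSpace E]

/-- The process with starting point `r₀` and update function `h`, driven by the sequence `X`. -/
def drivenProcess {E : Type*} (h : ℝ → E → ℝ) (r₀ : ℝ) (X : ℕ → E) : ℕ → ℝ
  | 0 => r₀
  | n + 1 => h (drivenProcess h r₀ X n) (X n)

variable {h : ℝ → E → ℝ} {r₀ : ℝ}

/-- The state at time `n` depends only on the coordinates before `n`; this makes it independent of
the next observation `X n`. -/
theorem measurable_drivenProcess_iSup (hh : Measurable (Function.uncurry h)) (n : ℕ) :
    Measurable[⨆ i ∈ Set.Iio n, MeasurableSpace.comap (fun X : ℕ → E => X i) inferInstance]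
      fun X : ℕ → E => drivenProcess h r₀ X n := by
  induction n with
  | zero => exact measurable_const
  | succ n ih =>
    refine hh.comp (Measurable.prodMk (ih.mono ?_ le_rfl) ?_)
    · exact biSup_mono fun i hi => Set.mem_Iio.2 ((Set.mem_Iio.1 hi).trans n.lt_succ_self)
    · refine Measurable.mono (comap_measurable _) ?_ le_rfl
      exact le_iSup₂_of_le n (Set.mem_Iio.2 n.lt_succ_self) le_rfl

theorem measurable_drivenProcess (hh : Measurable (Function.uncurry h)) (n : ℕ) :
    Measurable fun X : ℕ → E => drivenProcess h r₀ X n := by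
  refine (measurable_drivenProcess_iSup hh n).mono ?_ le_rfl
  exact iSup₂_le fun i _ => (measurable_pi_apply i).comap_le

variable {ν : ℕ → Measure E} [∀ n, IsProbabilityMeasure (ν n)]

theorem indepFun_drivenProcess_eval (hh : Measurable (Function.uncurry h)) (n : ℕ) :
    ProbabilityTheory.IndepFun (fun X : ℕ → E => drivenProcess h r₀ X n) (fun X => X n)
      (Measure.infinitePi ν) := by
  have hi : ProbabilityTheory.iIndepFun (fun i (X : ℕ → E) => X i) (Measure.infinitePi ν) :=
    ProbabilityTheory.iIndepFun_infinitePi (X := fun _ x => x) fun _ => measurable_id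
  have := ProbabilityTheory.indep_iSup_of_disjoint (S := Set.Iio n) (T := {n})
    (fun i => (measurable_pi_apply i).comap_le) hi (by simp)
  rw [ProbabilityTheory.IndepFun_iff_Indep]
  refine ProbabilityTheory.indep_of_indep_of_le_left
    (ProbabilityTheory.indep_of_indep_of_le_right this ?_)
    (measurable_drivenProcess_iSup hh n).comap_le
  simp

/-- By independence the joint law of the state and the next observation is a product, so Fubini
turns a drift bound at each fixed state into one for the mean. -/
theorem lintegral_drivenProcess_succ_le (hh : Measurable (Function.uncurry h))
    (hpos : ∀ X n, 0 ≤ drivenProcess h r₀ X n) {U : ℝ → ℝ≥0∞} (hU : Measurable U) {c : ℝ≥0∞} {n : ℕ}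
    (hstep : ∀ r, 0 ≤ r → ∫⁻ x, U (h r x) ∂(ν n) ≤ c * U r) :
    ∫⁻ X, U (drivenProcess h r₀ X (n + 1)) ∂(Measure.infinitePi ν) ≤
      c * ∫⁻ X, U (drivenProcess h r₀ X n) ∂(Measure.infinitePi ν) := by
  have hm := measurable_drivenProcess (r₀ := r₀) hh n
  have hUh : Measurable fun z : ℝ × E => U (h z.1 z.2) := hU.comp hh
  calc ∫⁻ X, U (drivenProcess h r₀ X (n + 1)) ∂(Measure.infinitePi ν)
      = ∫⁻ z, U (h z.1 z.2) ∂((Measure.infinitePi ν).map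
          fun X => (drivenProcess h r₀ X n, X n)) := by
        rw [lintegral_map hUh (hm.prodMk (measurable_pi_apply n))]
        rfl
    _ = ∫⁻ r, ∫⁻ x, U (h r x) ∂(ν n)
          ∂((Measure.infinitePi ν).map fun X => drivenProcess h r₀ X n) := by
        rw [(indepFun_drivenProcess_eval hh n).map_prod_eq_prod_map_map hm.aemeasurable
          (measurable_pi_apply n).aemeasurable]
        have : (Measure.infinitePi ν).map (fun X => X n) = ν n := Measure.infinitePi_map_eval _ n
        rw [this, lintegral_prod _ hUh.aemeasurable]
    _ = ∫⁻ X, ∫⁻ x, U (h (drivenProcess h r₀ X n) x) ∂(ν n) ∂(Measure.infinitePi ν) := by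
        rw [lintegral_map hUh.lintegral_prod_right' hm]
    _ ≤ ∫⁻ X, c * U (drivenProcess h r₀ X n) ∂(Measure.infinitePi ν) :=
        lintegral_mono fun X => hstep _ (hpos X n)
    _ = _ := lintegral_const_mul _ (hU.comp hm)

theorem ae_tendsto_average_eval {κ : Measure E} {m : ℕ} (hν : ∀ n, m ≤ n → ν n = κ)
    {φ : E → ℝ} (hφ : Measurable φ) (hint : Integrable φ κ) :
    ∀ᵐ X ∂(Measure.infinitePi ν),
      Tendsto (fun n : ℕ => (∑ i ∈ Finset.range n, φ (X (m + i))) / n) atTop (𝓝 (∫ x, φ x ∂κ)) := by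
  have hi : ProbabilityTheory.iIndepFun (fun i (X : ℕ → E) => φ (X i)) (Measure.infinitePi ν) :=
    ProbabilityTheory.iIndepFun_infinitePi (X := fun _ => φ) fun _ => hφ
  have hmp : ∀ i, MeasurePreserving (fun X : ℕ → E => X (m + i)) (Measure.infinitePi ν) κ :=
    fun i => by
      have := measurePreserving_eval_infinitePi ν (m + i)
      rwa [hν _ (by omega)] at this
  have := ProbabilityTheory.strong_law_ae_real (μ := Measure.infinitePi ν)
    (fun i (X : ℕ → E) => φ (X (m + i))) ((hmp 0).integrable_comp_of_integrable hint)
    (fun i j hij => hi.indepFun (by simpa using hij))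
    (fun i => ⟨(hφ.comp (measurable_pi_apply _)).aemeasurable,
      (hφ.comp (measurable_pi_apply _)).aemeasurable, by
        have e : ∀ i, Measure.map (fun X : ℕ → E => φ (X (m + i))) (Measure.infinitePi ν) =
            κ.map φ := fun i => by
          rw [← (hmp i).map_eq, Measure.map_map hφ (hmp i).measurable]; rfl
        rw [e, e]⟩)
  have hE : ∫ X, φ (X (m + 0)) ∂(Measure.infinitePi ν) = ∫ x, φ x ∂κ := by
    rw [← (hmp 0).map_eq, integral_map (hmp 0).measurable.aemeasurable hφ.aestronglyMeasurable]
  rwa [hE] at this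

end Driven

/-! ### Densities, likelihood ratios and the divergence. -/

section Density

variable {E : Type*} [MeasurableSpace E] {ν : Measure E} {f₀ f₁ : E → ℝ}

theorem IsProbDensity.isProbabilityMeasure {f : E → ℝ} (hf : IsProbDensity ν f) :
    IsProbabilityMeasure (densityLaw ν f) :=
  ⟨by rw [densityLaw, withDensity_apply _ MeasurableSet.univ, Measure.restrict_univ,
    hf.lintegral_eq_one]⟩

theorem lintegral_densityLaw {f : E → ℝ} (hf : IsProbDensity ν f) (u : E → ℝ≥0∞) (hu : Measurable u) :
    ∫⁻ x, u x ∂(densityLaw ν f) = ∫⁻ x, ENNReal.ofReal (f x) * u x ∂ν := by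
  rw [densityLaw, lintegral_withDensity_eq_lintegral_mul _ hf.measurable.ennreal_ofReal hu]
  rfl

/-- Finite divergence forces absolute continuity; in this form it excludes the points where `f₁ /
f₀` would take the default value of division by zero while `f₁ > 0`. -/
theorem ae_eq_zero_of_absolutelyContinuous (hf₀ : IsProbDensity ν f₀) (hf₁ : IsProbDensity ν f₁)
    (hac : densityLaw ν f₁ ≪ densityLaw ν f₀) : ∀ᵐ x ∂ν, f₀ x = 0 → f₁ x = 0 := by
  have h0 : ∀ᵐ x ∂(densityLaw ν f₀), f₀ x ≠ 0 := by
    rw [densityLaw, ae_withDensity_iff hf₀.measurable.ennreal_ofReal]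
    refine Eventually.of_forall fun x hx h => hx ?_
    simp [h]
  have h1 : ∀ᵐ x ∂(densityLaw ν f₁), f₀ x ≠ 0 := hac.ae_le h0
  rw [densityLaw, ae_withDensity_iff hf₁.measurable.ennreal_ofReal] at h1
  filter_upwards [h1] with x hx h
  by_contra hne
  exact hx (by simpa using (hf₁.nonneg x).lt_of_ne' hne) h

theorem ae_pos_div (hf₀ : IsProbDensity ν f₀) (hf₁ : IsProbDensity ν f₁)
    (hac : densityLaw ν f₁ ≪ densityLaw ν f₀) : ∀ᵐ x ∂(densityLaw ν f₁), 0 < f₁ x / f₀ x := by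
  rw [densityLaw, ae_withDensity_iff hf₁.measurable.ennreal_ofReal]
  filter_upwards [ae_eq_zero_of_absolutelyContinuous hf₀ hf₁ hac] with x hx hne
  have h1 : 0 < f₁ x := by simpa using hne
  have h0 : 0 < f₀ x := (hf₀.nonneg x).lt_of_ne' fun h => h1.ne' (hx h)
  positivity

theorem llr_densityLaw_ae_eq [SigmaFinite ν] (hf₀ : IsProbDensity ν f₀) (hf₁ : IsProbDensity ν f₁)
    (hac : densityLaw ν f₁ ≪ densityLaw ν f₀) :
    llr (densityLaw ν f₁) (densityLaw ν f₀) =ᵐ[densityLaw ν f₁]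
      fun x => Real.log (f₁ x / f₀ x) := by
  have := hf₀.isProbabilityMeasure
  have hm : Measurable fun x => ENNReal.ofReal (f₁ x / f₀ x) :=
    (hf₁.measurable.div hf₀.measurable).ennreal_ofReal
  have heq : densityLaw ν f₁ = (densityLaw ν f₀).withDensity
      fun x => ENNReal.ofReal (f₁ x / f₀ x) := by
    rw [densityLaw, densityLaw, ← withDensity_mul _ hf₀.measurable.ennreal_ofReal hm]
    refine withDensity_congr_ae ?_
    filter_upwards [ae_eq_zero_of_absolutelyContinuous hf₀ hf₁ hac] with x hx
    rw [Pi.mul_apply, ← ENNReal.ofReal_mul (hf₀.nonneg x)]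
    congr 1
    by_cases h : f₀ x = 0
    · simp [h, hx h]
    · field_simp
  have h := Measure.rnDeriv_withDensity (densityLaw ν f₀) hm
  rw [← heq] at h
  filter_upwards [hac.ae_le h] with x hx
  rw [llr, hx, ENNReal.toReal_ofReal (div_nonneg (hf₁.nonneg x) (hf₀.nonneg x))]

theorem integrable_log_and_integral_eq_divergence [SigmaFinite ν] (hf₀ : IsProbDensity ν f₀)
    (hf₁ : IsProbDensity ν f₁) (hD : divergence ν f₁ f₀ ≠ ∞) :
    Integrable (fun x => Real.log (f₁ x / f₀ x)) (densityLaw ν f₁) ∧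
      ∫ x, Real.log (f₁ x / f₀ x) ∂(densityLaw ν f₁) = (divergence ν f₁ f₀).toReal := by
  have := hf₀.isProbabilityMeasure
  have := hf₁.isProbabilityMeasure
  obtain ⟨hac, hint⟩ := InformationTheory.klDiv_ne_top_iff.1 hD
  have hae := llr_densityLaw_ae_eq hf₀ hf₁ hac
  refine ⟨hint.congr hae, ?_⟩
  rw [divergence, InformationTheory.toReal_klDiv_of_measure_eq hac (by simp), integral_congr_ae hae]

end Density

/-! ### Lyapunov function, tail bound and almost sure growth. -/

section Lyapunov

variable {E : Type*} [MeasurableSpace E] {ν : Measure E} {f₀ f₁ : E → ℝ} {g : ℝ → ℝ}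
  {ρ β r₀ : ℝ}

/-- A Lyapunov function of the odds process. The weight of the levels below `β` makes up for a
reset, which may increase the odds arbitrarily little. -/
noncomputable def lyapunov (ρ β r : ℝ) : ℝ :=
  (if r < β then (√(1 - ρ))⁻¹ else 1) / (r + ρ)

theorem measurable_lyapunov : Measurable (lyapunov ρ β) :=
  (Measurable.ite (measurableSet_lt measurable_id measurable_const) measurable_const
    measurable_const).div (measurable_id.add_const ρ)

theorem inv_add_le_lyapunov (hρ : 0 < ρ) (hρ1 : ρ < 1) {r : ℝ} (hr : 0 ≤ r) :
    (r + ρ)⁻¹ ≤ lyapunov ρ β r := by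
  have hθ : 0 < √(1 - ρ) := Real.sqrt_pos.2 (by linarith)
  have hθ1 : √(1 - ρ) ≤ 1 := Real.sqrt_le_one.2 (by linarith)
  rw [lyapunov, inv_eq_one_div]
  gcongr
  split_ifs
  · exact (one_le_inv₀ hθ).2 hθ1
  · exact le_rfl

theorem lyapunov_le (hρ : 0 < ρ) (hρ1 : ρ < 1) {r : ℝ} (hr : 0 ≤ r) :
    lyapunov ρ β r ≤ (√(1 - ρ))⁻¹ / (r + ρ) := by
  have hθ : 0 < √(1 - ρ) := Real.sqrt_pos.2 (by linarith)
  have hθ1 : √(1 - ρ) ≤ 1 := Real.sqrt_le_one.2 (by linarith)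
  rw [lyapunov]
  gcongr
  split_ifs
  · exact le_rfl
  · exact (one_le_inv₀ hθ).2 hθ1

/-- If the skip stays below `β`, it is a genuine update and `1 / (r + ρ)` shrinks by `1 - ρ = √(1 -
ρ) ^ 2`, more than needed. If it reaches `β`, the odds need not grow appreciably, but the weight
drops from `(√(1 - ρ))⁻¹` to `1`. -/
theorem lyapunov_skip_le (hg : IsSkipRule ρ β g) (hρ : 0 < ρ) (hρ1 : ρ < 1) {r : ℝ} (hr : 0 ≤ r)
    (hrβ : r < β) : lyapunov ρ β (g r) ≤ √(1 - ρ) * lyapunov ρ β r := by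
  have h1 : 0 < 1 - ρ := by linarith
  have hθ : 0 < √(1 - ρ) := Real.sqrt_pos.2 h1
  have hθ1 : √(1 - ρ) ≤ 1 := Real.sqrt_le_one.2 (by linarith)
  have hsq : √(1 - ρ) * √(1 - ρ) = 1 - ρ := Real.mul_self_sqrt h1.le
  have hrhs : √(1 - ρ) * lyapunov ρ β r = 1 / (r + ρ) := by
    rw [lyapunov, if_pos hrβ]
    field_simp
  have hgr := hg.le_self r hr hrβ
  rw [hrhs, lyapunov]
  split_ifs with h
  · rw [hg.eq_skip r hr h, inv_eq_one_div, div_div]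
    refine one_div_le_one_div_of_le (by positivity) ?_
    calc r + ρ = 1 * (r + ρ) := by ring
      _ ≤ (√(1 - ρ))⁻¹ * (r + ρ) := by
        gcongr
        exact (one_le_inv₀ hθ).2 hθ1
      _ = √(1 - ρ) * ((r + ρ) / (1 - ρ)) := by
        nth_rw 3 [← hsq]
        field_simp
      _ ≤ _ := by gcongr; linarith
  · gcongr

/-- Above `β`, taking an observation contracts `1 / (r + ρ)` by `(1 - ρ) / L`, and `1 / L` has mean
at most `∫ f₀ = 1` under `f₁`. Possibly falling below `β` costs a weight `(√(1 - ρ))⁻¹`, which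
leaves the factor `√(1 - ρ)`. -/
theorem lintegral_lyapunov_oddsStep_le (hf₀ : IsProbDensity ν f₀) (hf₁ : IsProbDensity ν f₁)
    (hac : densityLaw ν f₁ ≪ densityLaw ν f₀) (hg : IsSkipRule ρ β g) (hρ : 0 < ρ) (hρ1 : ρ < 1)
    {r : ℝ} (hr : 0 ≤ r) :
    ∫⁻ x, ENNReal.ofReal (lyapunov ρ β (oddsStep g ρ β r (f₁ x / f₀ x))) ∂(densityLaw ν f₁) ≤
      ENNReal.ofReal √(1 - ρ) * ENNReal.ofReal (lyapunov ρ β r) := by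
  have := hf₁.isProbabilityMeasure
  have h1 : 0 < 1 - ρ := by linarith
  have hθ : 0 < √(1 - ρ) := Real.sqrt_pos.2 h1
  have hsq : √(1 - ρ) * √(1 - ρ) = 1 - ρ := Real.mul_self_sqrt h1.le
  rw [← ENNReal.ofReal_mul hθ.le]
  by_cases hrβ : r < β
  · simp only [oddsStep, if_pos hrβ, lintegral_const, measure_univ, mul_one]
    exact ENNReal.ofReal_le_ofReal (lyapunov_skip_le hg hρ hρ1 hr hrβ)
  have hLm : Measurable fun x => f₁ x / f₀ x := hf₁.measurable.div hf₀.measurable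
  simp only [oddsStep, if_neg hrβ]
  have hm : Measurable fun x =>
      ENNReal.ofReal (lyapunov ρ β ((r + ρ) / (1 - ρ) * (f₁ x / f₀ x))) :=
    (measurable_lyapunov.comp (hLm.const_mul ((r + ρ) / (1 - ρ)))).ennreal_ofReal
  rw [lintegral_densityLaw hf₁ _ hm]
  have hc : lyapunov ρ β r = 1 / (r + ρ) := by rw [lyapunov, if_neg hrβ]
  calc ∫⁻ x, ENNReal.ofReal (f₁ x) *
        ENNReal.ofReal (lyapunov ρ β ((r + ρ) / (1 - ρ) * (f₁ x / f₀ x))) ∂ν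
      ≤ ∫⁻ x, ENNReal.ofReal (√(1 - ρ) * lyapunov ρ β r) * ENNReal.ofReal (f₀ x) ∂ν := by
        refine lintegral_mono_ae ?_
        filter_upwards [ae_eq_zero_of_absolutelyContinuous hf₀ hf₁ hac] with x hx
        rcases (hf₁.nonneg x).eq_or_lt with h | h
        · simp [← h]
        have h0 : 0 < f₀ x := (hf₀.nonneg x).lt_of_ne' fun h0 => h.ne' (hx h0)
        rw [← ENNReal.ofReal_mul h.le, ← ENNReal.ofReal_mul (by rw [hc]; positivity)]
        refine ENNReal.ofReal_le_ofReal ?_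
        have hs : 0 < (r + ρ) / (1 - ρ) * (f₁ x / f₀ x) := by positivity
        calc f₁ x * lyapunov ρ β ((r + ρ) / (1 - ρ) * (f₁ x / f₀ x))
            ≤ f₁ x * ((√(1 - ρ))⁻¹ / ((r + ρ) / (1 - ρ) * (f₁ x / f₀ x))) := by
              gcongr
              refine (lyapunov_le hρ hρ1 hs.le).trans ?_
              gcongr
              linarith
          _ = √(1 - ρ) * lyapunov ρ β r * f₀ x := by
              rw [hc]
              nth_rw 2 [← hsq]
              field_simp
    _ = _ := by
        rw [lintegral_const_mul _ hf₀.measurable.ennreal_ofReal, hf₀.lintegral_eq_one, mul_one]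

/-- The odds process with skipping rule `g` below the level `β`, started at `r₀`. -/
noncomputable def oddsProcess (f₀ f₁ : E → ℝ) (g : ℝ → ℝ) (ρ β r₀ : ℝ) (X : ℕ → E) : ℕ → ℝ :=
  drivenProcess (fun r x => oddsStep g ρ β r (f₁ x / f₀ x)) r₀ X

theorem measurable_oddsStep (hf₀ : IsProbDensity ν f₀) (hf₁ : IsProbDensity ν f₁)
    (hg : IsSkipRule ρ β g) :
    Measurable (Function.uncurry fun r x => oddsStep g ρ β r (f₁ x / f₀ x)) :=
  Measurable.ite (measurableSet_lt measurable_fst measurable_const)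
    (hg.measurable.comp measurable_fst)
    (((measurable_fst.add_const ρ).div_const (1 - ρ)).mul
      ((hf₁.measurable.comp measurable_snd).div (hf₀.measurable.comp measurable_snd)))

theorem measurable_oddsProcess (hf₀ : IsProbDensity ν f₀) (hf₁ : IsProbDensity ν f₁)
    (hg : IsSkipRule ρ β g) (n : ℕ) : Measurable fun X => oddsProcess f₀ f₁ g ρ β r₀ X n :=
  measurable_drivenProcess (measurable_oddsStep hf₀ hf₁ hg) n

theorem oddsProcess_nonneg (hf₀ : IsProbDensity ν f₀) (hf₁ : IsProbDensity ν f₁)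
    (hg : IsSkipRule ρ β g) (hρ : 0 < ρ) (hρ1 : ρ < 1) (hr₀ : 0 ≤ r₀) (X : ℕ → E) (n : ℕ) :
    0 ≤ oddsProcess f₀ f₁ g ρ β r₀ X n := by
  induction n with
  | zero => exact hr₀
  | succ n ih =>
    change 0 ≤ oddsStep g ρ β (oddsProcess f₀ f₁ g ρ β r₀ X n) (f₁ (X n) / f₀ (X n))
    rw [oddsStep]
    split_ifs with h
    · exact ih.trans (hg.le_self _ ih h)
    · have := hf₀.nonneg (X n)
      have := hf₁.nonneg (X n)
      have : 0 < 1 - ρ := by linarith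
      positivity

theorem isProbabilityMeasure_changeLaw_factor (hf₀ : IsProbDensity ν f₀)
    (hf₁ : IsProbDensity ν f₁) (l n : ℕ) :
    IsProbabilityMeasure (if n + 1 < l then densityLaw ν f₀ else densityLaw ν f₁) := by
  have := hf₀.isProbabilityMeasure
  have := hf₁.isProbabilityMeasure
  split_ifs <;> infer_instance

theorem isProbabilityMeasure_changeLaw (hf₀ : IsProbDensity ν f₀) (hf₁ : IsProbDensity ν f₁)
    (l : ℕ) : IsProbabilityMeasure (changeLaw ν f₀ f₁ l) := by
  have := isProbabilityMeasure_changeLaw_factor hf₀ hf₁ l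
  rw [changeLaw]
  infer_instance

/-- Coordinate `l - 1` is the first one with density `f₁` (truncated subtraction covers `l = 0`).
The Lyapunov function is bounded by its largest possible value there, whatever the past, and the
contraction is iterated from then on. -/
theorem lintegral_lyapunov_oddsProcess_le (hf₀ : IsProbDensity ν f₀) (hf₁ : IsProbDensity ν f₁)
    (hac : densityLaw ν f₁ ≪ densityLaw ν f₀) (hg : IsSkipRule ρ β g) (hρ : 0 < ρ) (hρ1 : ρ < 1)
    (hr₀ : 0 ≤ r₀) (l j : ℕ) :
    ∫⁻ X, ENNReal.ofReal (lyapunov ρ β (oddsProcess f₀ f₁ g ρ β r₀ X (l - 1 + j)))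
      ∂(changeLaw ν f₀ f₁ l) ≤ ENNReal.ofReal (√(1 - ρ) ^ j * ((√(1 - ρ))⁻¹ / ρ)) := by
  have := isProbabilityMeasure_changeLaw hf₀ hf₁ l
  have := isProbabilityMeasure_changeLaw_factor hf₀ hf₁ l
  have hpos := oddsProcess_nonneg (r₀ := r₀) hf₀ hf₁ hg hρ hρ1 hr₀
  induction j with
  | zero =>
    calc _ ≤ ∫⁻ _, ENNReal.ofReal ((√(1 - ρ))⁻¹ / ρ) ∂(changeLaw ν f₀ f₁ l) := by
          refine lintegral_mono fun X => ENNReal.ofReal_le_ofReal ?_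
          refine (lyapunov_le hρ hρ1 (hpos X _)).trans ?_
          gcongr
          have := hpos X (l - 1 + 0)
          linarith
      _ ≤ _ := by simp
  | succ j ih =>
    refine (lintegral_drivenProcess_succ_le
      (ν := fun n => if n + 1 < l then densityLaw ν f₀ else densityLaw ν f₁)
      (U := fun r => ENNReal.ofReal (lyapunov ρ β r)) (c := ENNReal.ofReal √(1 - ρ))
      (n := l - 1 + j) (measurable_oddsStep hf₀ hf₁ hg) hpos measurable_lyapunov.ennreal_ofReal
      fun r hr => ?_).trans ?_
    · rw [if_neg (by omega)]
      exact lintegral_lyapunov_oddsStep_le hf₀ hf₁ hac hg hρ hρ1 hr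
    · refine (mul_le_mul_right ih _).trans ?_
      rw [← ENNReal.ofReal_mul (Real.sqrt_nonneg _)]
      exact ENNReal.ofReal_le_ofReal (by rw [pow_succ]; linarith)

/-- Once the observations have density `f₁`, the odds process leaves bounded sets exponentially
fast, uniformly in the past. -/
theorem changeLaw_oddsProcess_le_le (hf₀ : IsProbDensity ν f₀) (hf₁ : IsProbDensity ν f₁)
    (hac : densityLaw ν f₁ ≪ densityLaw ν f₀) (hg : IsSkipRule ρ β g) (hρ : 0 < ρ) (hρ1 : ρ < 1)
    (hr₀ : 0 ≤ r₀) (l j : ℕ) {x : ℝ} (hx : 1 ≤ x) :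
    changeLaw ν f₀ f₁ l {X | oddsProcess f₀ f₁ g ρ β r₀ X (l - 1 + j) ≤ x} ≤
      ENNReal.ofReal (2 * ((√(1 - ρ))⁻¹ / ρ) * x * √(1 - ρ) ^ j) := by
  have hpos := oddsProcess_nonneg (r₀ := r₀) hf₀ hf₁ hg hρ hρ1 hr₀
  -- Markov's inequality is applied at level `(2 * x)⁻¹`, because `r ≤ x` and `ρ < 1 ≤ x` give `r +
  -- ρ ≤ 2 * x`.
  have hx0 : 0 < 2 * x := by linarith
  have hm := (measurable_lyapunov (ρ := ρ) (β := β)).comp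
    (measurable_oddsProcess (r₀ := r₀) hf₀ hf₁ hg (l - 1 + j))
  calc changeLaw ν f₀ f₁ l {X | oddsProcess f₀ f₁ g ρ β r₀ X (l - 1 + j) ≤ x}
      ≤ changeLaw ν f₀ f₁ l {X | ENNReal.ofReal (2 * x)⁻¹ ≤
          ENNReal.ofReal (lyapunov ρ β (oddsProcess f₀ f₁ g ρ β r₀ X (l - 1 + j)))} := by
        refine measure_mono fun X hX => ENNReal.ofReal_le_ofReal ?_
        refine le_trans ?_ (inv_add_le_lyapunov hρ hρ1 (hpos X _))
        have h1 := hpos X (l - 1 + j)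
        have h2 : oddsProcess f₀ f₁ g ρ β r₀ X (l - 1 + j) ≤ x := hX
        gcongr
        linarith
    _ ≤ _ := meas_ge_le_lintegral_div hm.ennreal_ofReal.aemeasurable
        (by simpa using hx0) ENNReal.ofReal_ne_top
    _ ≤ ENNReal.ofReal (√(1 - ρ) ^ j * ((√(1 - ρ))⁻¹ / ρ)) / ENNReal.ofReal (2 * x)⁻¹ :=
        ENNReal.div_le_div_right
          (lintegral_lyapunov_oddsProcess_le hf₀ hf₁ hac hg hρ hρ1 hr₀ l j) _
    _ = _ := by
        rw [← ENNReal.ofReal_div_of_pos (by positivity)]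
        congr 1
        field_simp

/-- Borel–Cantelli: for each bound the tail probabilities are summable in `j`. -/
theorem ae_tendsto_oddsProcess_atTop (hf₀ : IsProbDensity ν f₀) (hf₁ : IsProbDensity ν f₁)
    (hac : densityLaw ν f₁ ≪ densityLaw ν f₀) (hg : IsSkipRule ρ β g) (hρ : 0 < ρ) (hρ1 : ρ < 1)
    (hr₀ : 0 ≤ r₀) (l : ℕ) :
    ∀ᵐ X ∂(changeLaw ν f₀ f₁ l),
      Tendsto (fun j => oddsProcess f₀ f₁ g ρ β r₀ X (l - 1 + j)) atTop atTop := by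
  have hθ1 : √(1 - ρ) < 1 := (Real.sqrt_lt' one_pos).2 (by linarith)
  have key : ∀ N : ℕ, ∀ᵐ X ∂(changeLaw ν f₀ f₁ l),
      ∀ᶠ j in atTop, ¬ oddsProcess f₀ f₁ g ρ β r₀ X (l - 1 + j) ≤ (N + 1 : ℝ) := fun N => by
    refine ae_eventually_notMem
      (s := fun j => {X | oddsProcess f₀ f₁ g ρ β r₀ X (l - 1 + j) ≤ (N + 1 : ℝ)}) ?_
    refine ne_top_of_le_ne_top ?_ (ENNReal.tsum_le_tsum fun j =>
      changeLaw_oddsProcess_le_le hf₀ hf₁ hac hg hρ hρ1 hr₀ l j (by simp))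
    exact ((summable_geometric_of_lt_one (Real.sqrt_nonneg _) hθ1).mul_left _).tsum_ofReal_ne_top
  filter_upwards [ae_all_iff.2 key] with X hX
  refine tendsto_atTop.2 fun b => ?_
  obtain ⟨N, hN⟩ := exists_nat_ge b
  filter_upwards [hX N] with j hj
  linarith [not_le.1 hj]

/-- Almost sure growth rate of the odds process after the change. -/
theorem ae_tendsto_log_oddsProcess_div [SigmaFinite ν] (hf₀ : IsProbDensity ν f₀)
    (hf₁ : IsProbDensity ν f₁) (hD : divergence ν f₁ f₀ ≠ ∞) (hg : IsSkipRule ρ β g) (hρ : 0 < ρ)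
    (hρ1 : ρ < 1) (hβ : 0 ≤ β) (hr₀ : 0 ≤ r₀) (l : ℕ) :
    ∀ᵐ X ∂(changeLaw ν f₀ f₁ l),
      Tendsto (fun n : ℕ => Real.log (oddsProcess f₀ f₁ g ρ β r₀ X n) / n) atTop
        (𝓝 ((divergence ν f₁ f₀).toReal - Real.log (1 - ρ))) := by
  have hac := (InformationTheory.klDiv_ne_top_iff.1 hD).1
  obtain ⟨hint, hE⟩ := integrable_log_and_integral_eq_divergence hf₀ hf₁ hD
  have := isProbabilityMeasure_changeLaw_factor hf₀ hf₁ l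
  have hLm : Measurable fun x => f₁ x / f₀ x := hf₁.measurable.div hf₀.measurable
  have hν : ∀ n, l - 1 ≤ n →
      (if n + 1 < l then densityLaw ν f₀ else densityLaw ν f₁) = densityLaw ν f₁ :=
    fun n hn => if_neg (by omega)
  have hslln := ae_tendsto_average_eval hν hLm.log hint
  rw [hE] at hslln
  have hLpos : ∀ᵐ X ∂(changeLaw ν f₀ f₁ l), ∀ i, 0 < f₁ (X (l - 1 + i)) / f₀ (X (l - 1 + i)) := by
    refine ae_all_iff.2 fun i => ?_
    have hmp := measurePreserving_eval_infinitePi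
      (fun n => if n + 1 < l then densityLaw ν f₀ else densityLaw ν f₁) (l - 1 + i)
    rw [hν _ (by omega)] at hmp
    exact hmp.quasiMeasurePreserving.ae (ae_pos_div hf₀ hf₁ hac)
  filter_upwards [hslln, hLpos, ae_tendsto_oddsProcess_atTop hf₀ hf₁ hac hg hρ hρ1 hr₀ l]
    with X h1 h2 h3
  refine tendsto_div_of_tendsto_add_div (l - 1) ?_
  exact tendsto_log_oddsStep_div hg hρ hρ1 hβ ENNReal.toReal_nonneg h2
    (fun n => oddsProcess_nonneg hf₀ hf₁ hg hρ hρ1 hr₀ X _) (fun n => rfl) h3 h1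

end Lyapunov

/-! ### Translation from posterior probabilities to odds. -/

section Odds

variable {ρ : ℝ}

/-- The odds corresponding to the probability `p`. -/
noncomputable def odds (p : ℝ) : ℝ := p / (1 - p)

theorem odds_lt_odds {p q : ℝ} (hp : p < 1) (hq : q < 1) : odds p < odds q ↔ p < q := by
  have h1 : 0 < 1 - p := by linarith
  have h2 : 0 < 1 - q := by linarith
  rw [odds, odds, div_lt_div_iff₀ h1 h2]
  constructor <;> intro h <;> nlinarith

theorem odds_nonneg {p : ℝ} (hp : 0 ≤ p) (hp1 : p < 1) : 0 ≤ odds p :=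
  div_nonneg hp (by linarith)

theorem odds_sigmoid (a : ℝ) : odds (Real.sigmoid a) = Real.exp a := by
  have := Real.exp_pos a
  rw [odds, ← Real.sigmoid_neg, ← Real.sigmoid_mul_rexp_neg, Real.exp_neg]
  have := Real.sigmoid_pos a
  field_simp

theorem skipUpdate_mem (hρ : 0 < ρ) (hρ1 : ρ < 1) {p : ℝ} (hp : 0 ≤ p) (hp1 : p < 1) :
    0 ≤ skipUpdate ρ p ∧ skipUpdate ρ p < 1 := by
  constructor <;> rw [skipUpdate] <;> nlinarith

theorem odds_skipUpdate (hρ1 : ρ < 1) {p : ℝ} (hp1 : p < 1) :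
    odds (skipUpdate ρ p) = (odds p + ρ) / (1 - ρ) := by
  have h1 : 1 - p ≠ 0 := by linarith
  have h2 : 1 - ρ ≠ 0 := by linarith
  have h3 : 1 - (p + (1 - p) * ρ) = (1 - p) * (1 - ρ) := by ring
  rw [odds, odds, skipUpdate, h3]
  field_simp

theorem takeUpdate_mem (hρ : 0 < ρ) (hρ1 : ρ < 1) {p L : ℝ} (hp : 0 ≤ p) (hp1 : p < 1)
    (hL : 0 ≤ L) : 0 ≤ takeUpdate ρ p L ∧ takeUpdate ρ p L < 1 := by
  obtain ⟨h0, h1⟩ := skipUpdate_mem hρ hρ1 hp hp1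
  have h2 : 0 < 1 - skipUpdate ρ p := by linarith
  refine ⟨by rw [takeUpdate]; positivity, ?_⟩
  rw [takeUpdate, div_lt_one (by positivity)]
  linarith

theorem odds_takeUpdate (hρ : 0 < ρ) (hρ1 : ρ < 1) {p L : ℝ} (hp : 0 ≤ p) (hp1 : p < 1)
    (hL : 0 ≤ L) : odds (takeUpdate ρ p L) = (odds p + ρ) / (1 - ρ) * L := by
  obtain ⟨h0, h1⟩ := skipUpdate_mem hρ hρ1 hp hp1
  rw [← odds_skipUpdate hρ1 hp1, takeUpdate, odds, odds]
  generalize skipUpdate ρ p = q at *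
  have h2 : 0 < 1 - q := by linarith
  have h3 : 0 < q * L + (1 - q) := by positivity
  have h4 : 1 - q * L / (q * L + (1 - q)) = (1 - q) / (q * L + (1 - q)) := by
    field_simp
    ring
  rw [h4]
  field_simp

variable {E : Type*} {f₀ f₁ : E → ℝ} {B : ℝ}

theorem controlStep_mem (h₀ : ∀ x, 0 ≤ f₀ x) (h₁ : ∀ x, 0 ≤ f₁ x) (hρ : 0 < ρ) (hρ1 : ρ < 1)
    {p : ℝ} (hp : 0 ≤ p) (hp1 : p < 1) (x : E) :
    0 ≤ controlStep f₀ f₁ ρ B p x ∧ controlStep f₀ f₁ ρ B p x < 1 := by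
  rw [controlStep]
  split_ifs
  · exact skipUpdate_mem hρ hρ1 hp hp1
  · exact takeUpdate_mem hρ hρ1 hp hp1 (div_nonneg (h₁ x) (h₀ x))

theorem odds_controlStep (h₀ : ∀ x, 0 ≤ f₀ x) (h₁ : ∀ x, 0 ≤ f₁ x) (hρ : 0 < ρ) (hρ1 : ρ < 1)
    (hB : B < 1) {p : ℝ} (hp : 0 ≤ p) (hp1 : p < 1) (x : E) :
    odds (controlStep f₀ f₁ ρ B p x) =
      oddsStep (fun r => (r + ρ) / (1 - ρ)) ρ (odds B) (odds p) (f₁ x / f₀ x) := by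
  simp only [controlStep, oddsStep, odds_lt_odds hp1 hB]
  split_ifs
  · exact odds_skipUpdate hρ1 hp1
  · exact odds_takeUpdate hρ hρ1 hp hp1 (div_nonneg (h₁ x) (h₀ x))

theorem le_add_div {r : ℝ} (hρ : 0 < ρ) (hρ1 : ρ < 1) (hr : 0 ≤ r) : r ≤ (r + ρ) / (1 - ρ) := by
  rw [le_div_iff₀ (by linarith)]
  nlinarith

theorem isSkipRule_skip (hρ : 0 < ρ) (hρ1 : ρ < 1) (β : ℝ) :
    IsSkipRule ρ β fun r => (r + ρ) / (1 - ρ) where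
  measurable := (measurable_id.add_const ρ).div_const (1 - ρ)
  le_self _ hr _ := le_add_div hρ hρ1 hr
  le_skip _ := le_rfl
  eq_skip _ _ _ := rfl

/-- A process below `β` skips, so it can cross `β` from below only by a skip; resetting it there
means capping the skip at `β`. -/
theorem isSkipRule_min (hρ : 0 < ρ) (hρ1 : ρ < 1) (β : ℝ) :
    IsSkipRule ρ β fun r => min β ((r + ρ) / (1 - ρ)) where
  measurable := measurable_const.min ((measurable_id.add_const ρ).div_const (1 - ρ))
  le_self _ hr hβ := le_min hβ.le (le_add_div hρ hρ1 hr)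
  le_skip _ := min_le_right _ _
  eq_skip r _ h := min_eq_right (le_of_lt (by simpa using h))

theorem posterior_mem_and_odds_eq (h₀ : ∀ x, 0 ≤ f₀ x) (h₁ : ∀ x, 0 ≤ f₁ x) (hρ : 0 < ρ)
    (hρ1 : ρ < 1) (hB : B < 1) {p₀ : ℝ} (hp : 0 ≤ p₀) (hp1 : p₀ < 1) (X : ℕ → E) (k : ℕ) :
    (0 ≤ posterior f₀ f₁ ρ B p₀ X k ∧ posterior f₀ f₁ ρ B p₀ X k < 1) ∧
      odds (posterior f₀ f₁ ρ B p₀ X k) =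
        oddsProcess f₀ f₁ (fun r => (r + ρ) / (1 - ρ)) ρ (odds B) (odds p₀) X k := by
  induction k with
  | zero => exact ⟨⟨hp, hp1⟩, rfl⟩
  | succ k ih =>
    obtain ⟨⟨ih0, ih1⟩, ih2⟩ := ih
    rw [posterior]
    refine ⟨controlStep_mem h₀ h₁ hρ hρ1 ih0 ih1 _, ?_⟩
    rw [odds_controlStep h₀ h₁ hρ hρ1 hB ih0 ih1, ih2]
    rfl

theorem stopTime_eq_firstPassage (h₀ : ∀ x, 0 ≤ f₀ x) (h₁ : ∀ x, 0 ≤ f₁ x) (hρ : 0 < ρ)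
    (hρ1 : ρ < 1) (hB : B < 1) {p₀ : ℝ} (hp : 0 ≤ p₀) (hp1 : p₀ < 1) (a : ℝ) (X : ℕ → E) :
    stopTime f₀ f₁ ρ (Real.sigmoid a) B p₀ X =
      firstPassage (oddsProcess f₀ f₁ (fun r => (r + ρ) / (1 - ρ)) ρ (odds B) (odds p₀) X)
        (Real.exp a) := by
  have key : ∀ k, Real.sigmoid a < posterior f₀ f₁ ρ B p₀ X k ↔ Real.exp a <
      oddsProcess f₀ f₁ (fun r => (r + ρ) / (1 - ρ)) ρ (odds B) (odds p₀) X k := fun k => by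
    obtain ⟨⟨_, h2⟩, h3⟩ := posterior_mem_and_odds_eq h₀ h₁ hρ hρ1 hB hp hp1 X k
    rw [← h3, ← odds_sigmoid, odds_lt_odds (Real.sigmoid_lt_one a) h2]
  simp only [stopTime, firstPassage, key]

theorem resetPosterior_mem_and_odds_eq (h₀ : ∀ x, 0 ≤ f₀ x) (h₁ : ∀ x, 0 ≤ f₁ x) (hρ : 0 < ρ)
    (hρ1 : ρ < 1) (hB0 : 0 ≤ B) (hB : B < 1) (X : ℕ → E) (k : ℕ) :
    (0 ≤ resetPosterior f₀ f₁ ρ B X k ∧ resetPosterior f₀ f₁ ρ B X k < 1) ∧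
      odds (resetPosterior f₀ f₁ ρ B X k) =
        oddsProcess f₀ f₁ (fun r => min (odds B) ((r + ρ) / (1 - ρ))) ρ (odds B) (odds B) X k := by
  induction k with
  | zero => exact ⟨⟨hB0, hB⟩, rfl⟩
  | succ k ih =>
    obtain ⟨⟨ih0, ih1⟩, ih2⟩ := ih
    have hq := controlStep_mem (B := B) h₀ h₁ hρ hρ1 ih0 ih1 (X k)
    have hodds := odds_controlStep h₀ h₁ hρ hρ1 hB ih0 ih1 (X k)
    have hstep : oddsProcess f₀ f₁ (fun r => min (odds B) ((r + ρ) / (1 - ρ))) ρ (odds B) (odds B)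
        X (k + 1) = oddsStep (fun r => min (odds B) ((r + ρ) / (1 - ρ))) ρ (odds B)
        (odds (resetPosterior f₀ f₁ ρ B X k)) (f₁ (X k) / f₀ (X k)) := by rw [ih2]; rfl
    rw [hstep]
    simp only [resetPosterior]
    refine ⟨by split_ifs; exacts [⟨hB0, hB⟩, hq], ?_⟩
    by_cases hlt : resetPosterior f₀ f₁ ρ B X k < B
    · rw [oddsStep, if_pos ((odds_lt_odds ih1 hB).2 hlt)] at hodds ⊢
      by_cases hle : B ≤ controlStep f₀ f₁ ρ B (resetPosterior f₀ f₁ ρ B X k) (X k)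
      · have : odds B ≤ odds (controlStep f₀ f₁ ρ B (resetPosterior f₀ f₁ ρ B X k) (X k)) :=
          not_lt.1 fun h => not_lt.2 hle ((odds_lt_odds hq.2 hB).1 h)
        rw [if_pos ⟨hlt, hle⟩, min_eq_left (hodds ▸ this)]
      · have := (odds_lt_odds hq.2 hB).2 (not_le.1 hle)
        rw [if_neg (fun h => hle h.2), min_eq_right (hodds ▸ this.le), hodds]
    · have hlt' : ¬ odds (resetPosterior f₀ f₁ ρ B X k) < odds B :=
        fun h => hlt ((odds_lt_odds ih1 hB).1 h)
      rw [if_neg (fun h => hlt h.1), hodds, oddsStep, oddsStep, if_neg hlt', if_neg hlt']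

/-- `resetTime` tests the value before the reset, the odds process the one after. They can differ
only after a skip, and by `ha` no skip from below `B` exceeds `a`, so both tests then fail. -/
theorem resetTime_eq_firstPassage (h₀ : ∀ x, 0 ≤ f₀ x) (h₁ : ∀ x, 0 ≤ f₁ x) (hρ : 0 < ρ)
    (hρ1 : ρ < 1) (hB0 : 0 ≤ B) (hB : B < 1) {a : ℝ} (ha : (odds B + ρ) / (1 - ρ) ≤ Real.exp a)
    (X : ℕ → E) :
    resetTime f₀ f₁ ρ (Real.sigmoid a) B X =
      firstPassage (oddsProcess f₀ f₁ (fun r => min (odds B) ((r + ρ) / (1 - ρ))) ρ (odds B)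
        (odds B) X) (Real.exp a) := by
  set r := oddsProcess f₀ f₁ (fun r => min (odds B) ((r + ρ) / (1 - ρ))) ρ (odds B) (odds B) X
  have key : ∀ k, Real.sigmoid a < controlStep f₀ f₁ ρ B (resetPosterior f₀ f₁ ρ B X k) (X k) ↔
      Real.exp a < r (k + 1) := fun k => by
    obtain ⟨⟨ih0, ih1⟩, ih2⟩ := resetPosterior_mem_and_odds_eq h₀ h₁ hρ hρ1 hB0 hB X k
    have hq := controlStep_mem (B := B) h₀ h₁ hρ hρ1 ih0 ih1 (X k)
    have hr : r (k + 1) = oddsStep (fun r => min (odds B) ((r + ρ) / (1 - ρ))) ρ (odds B)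
        (odds (resetPosterior f₀ f₁ ρ B X k)) (f₁ (X k) / f₀ (X k)) := by rw [ih2]; rfl
    rw [← odds_lt_odds (Real.sigmoid_lt_one a) hq.2, odds_sigmoid,
      odds_controlStep h₀ h₁ hρ hρ1 hB ih0 ih1, hr, oddsStep, oddsStep]
    split_ifs with h
    · have h1 : (odds (resetPosterior f₀ f₁ ρ B X k) + ρ) / (1 - ρ) ≤ Real.exp a := by
        refine le_trans ?_ ha
        have : 0 < 1 - ρ := by linarith
        gcongr
      exact iff_of_false (not_lt.2 h1) (not_lt.2 ((min_le_right _ _).trans h1))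
    · rfl
  refine le_antisymm (le_iInf₂ fun k hk => ?_) (le_iInf₂ fun k hk => ?_)
  · obtain ⟨m, rfl⟩ : ∃ m, k = m + 1 := ⟨k - 1, by omega⟩
    exact iInf₂_le m ((key m).2 hk.2)
  · exact iInf₂_le (k + 1) ⟨by omega, (key k).1 hk⟩

end Odds

/-! ### Mixing over the change point. -/

section JointLaw

variable {E : Type*} [MeasurableSpace E] {ν : Measure E} {f₀ f₁ : E → ℝ} {π₀ ρ : ℝ}

theorem tsum_ofReal_prior (hπ₀ : 0 ≤ π₀) (hπ₁ : π₀ ≤ 1) (hρ : 0 < ρ) (hρ1 : ρ < 1) :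
    ∑' k, ENNReal.ofReal (prior π₀ ρ k) = 1 := by
  have h1 : 0 ≤ 1 - ρ := by linarith
  have h2 : 0 ≤ 1 - π₀ := by linarith
  have hs : HasSum (fun k => prior π₀ ρ (k + 1)) (1 - π₀) := by
    have := ((hasSum_geometric_of_lt_one h1 (by linarith)).mul_left ρ).mul_left (1 - π₀)
    rw [sub_sub_cancel, mul_inv_cancel₀ hρ.ne', mul_one] at this
    simpa [prior] using this
  have hs' := (hasSum_nat_add_iff' (f := prior π₀ ρ) (g := 1) 1).1 (by simpa [prior] using hs)
  rw [← ENNReal.ofReal_tsum_of_nonneg _ hs'.summable, hs'.tsum_eq, ENNReal.ofReal_one]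
  intro k
  rw [prior]
  split_ifs <;> positivity

theorem ae_jointLaw_of_forall (hf₀ : IsProbDensity ν f₀) (hf₁ : IsProbDensity ν f₁)
    {p : ℕ × (ℕ → E) → Prop}
    (h : ∀ k, ∀ᵐ X ∂(changeLaw ν f₀ f₁ k), p (k, X)) : ∀ᵐ ω ∂(jointLaw ν f₀ f₁ π₀ ρ), p ω := by
  have := isProbabilityMeasure_changeLaw hf₀ hf₁
  rw [jointLaw, Measure.ae_sum_iff]
  refine fun k => Measure.ae_smul_measure ?_ _
  rw [Measure.dirac_prod, (measurableEmbedding_prodMk_left k).ae_map_iff]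
  exact h k

theorem jointLaw_le_of_forall (hf₀ : IsProbDensity ν f₀) (hf₁ : IsProbDensity ν f₁)
    (hπ₀ : 0 ≤ π₀) (hπ₁ : π₀ ≤ 1) (hρ : 0 < ρ) (hρ1 : ρ < 1) {s : Set (ℕ × (ℕ → E))}
    (hs : MeasurableSet s) {c : ℝ≥0∞}
    (h : ∀ k, changeLaw ν f₀ f₁ k (Prod.mk k ⁻¹' s) ≤ c) : jointLaw ν f₀ f₁ π₀ ρ s ≤ c := by
  have := isProbabilityMeasure_changeLaw hf₀ hf₁
  rw [jointLaw, Measure.sum_apply _ hs]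
  calc _ ≤ ∑' k, ENNReal.ofReal (prior π₀ ρ k) * c := by
        refine ENNReal.tsum_le_tsum fun k => ?_
        rw [Measure.smul_apply, smul_eq_mul, Measure.dirac_prod,
          Measure.map_apply measurable_prodMk_left hs]
        gcongr
        exact h k
    _ = c := by rw [ENNReal.tsum_mul_right, tsum_ofReal_prior hπ₀ hπ₁ hρ hρ1, one_mul]

theorem isProbabilityMeasure_jointLaw (hf₀ : IsProbDensity ν f₀) (hf₁ : IsProbDensity ν f₁)
    (hπ₀ : 0 ≤ π₀) (hπ₁ : π₀ ≤ 1) (hρ : 0 < ρ) (hρ1 : ρ < 1) :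
    IsProbabilityMeasure (jointLaw ν f₀ f₁ π₀ ρ) := by
  have := isProbabilityMeasure_changeLaw hf₀ hf₁
  refine ⟨?_⟩
  rw [jointLaw, Measure.sum_apply _ MeasurableSet.univ]
  simpa using tsum_ofReal_prior hπ₀ hπ₁ hρ hρ1

end JointLaw

/-! ### Asymptotics of the three delays. -/

section Delay

variable {E : Type*} [MeasurableSpace E] {ν : Measure E} {f₀ f₁ : E → ℝ} {π₀ ρ : ℝ}

theorem growthRate_pos (hρ : 0 < ρ) (hρ1 : ρ < 1) :
    0 < (divergence ν f₁ f₀).toReal - Real.log (1 - ρ) := by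
  have : Real.log (1 - ρ) < 0 := Real.log_neg (by linarith) (by linarith)
  have : 0 ≤ (divergence ν f₁ f₀).toReal := ENNReal.toReal_nonneg
  linarith

theorem sqrt_one_sub_pos_and_lt_one (hρ : 0 < ρ) (hρ1 : ρ < 1) : 0 < √(1 - ρ) ∧ √(1 - ρ) < 1 :=
  ⟨Real.sqrt_pos.2 (by linarith), (Real.sqrt_lt' one_pos).2 (by linarith)⟩

/-- First-order asymptotics of the average delay of the procedure with observation control at a
fixed level. -/
theorem tendsto_condDelay_div [SigmaFinite ν] (hf₀ : IsProbDensity ν f₀) (hf₁ : IsProbDensity ν f₁)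
    (hD : divergence ν f₁ f₀ ≠ ∞) (hπ₀ : 0 ≤ π₀) (hπ₁ : π₀ < 1) (hρ : 0 < ρ) (hρ1 : ρ < 1)
    {B : ℝ} (hB0 : 0 ≤ B) (hB : B < 1) :
    Tendsto (fun a : ℝ => condDelay ν f₀ f₁ π₀ ρ (Real.sigmoid a) B / ENNReal.ofReal a) atTop
      (𝓝 (ENNReal.ofReal ((divergence ν f₁ f₀).toReal - Real.log (1 - ρ))⁻¹)) := by
  have hac := (InformationTheory.klDiv_ne_top_iff.1 hD).1
  have := isProbabilityMeasure_jointLaw hf₀ hf₁ hπ₀ hπ₁.le hρ hρ1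
  have hg := isSkipRule_skip hρ hρ1 (odds B)
  have hr₀ := odds_nonneg hπ₀ hπ₁
  have hβ := odds_nonneg hB0 hB
  obtain ⟨hθ, hθ1⟩ := sqrt_one_sub_pos_and_lt_one hρ hρ1
  set P := jointLaw ν f₀ f₁ π₀ ρ with hP
  set R : ℕ × (ℕ → E) → ℕ → ℝ := fun ω =>
    oddsProcess f₀ f₁ (fun r => (r + ρ) / (1 - ρ)) ρ (odds B) (odds π₀) ω.2 with hR
  have hRm : ∀ n, Measurable fun ω => R ω n := fun n =>
    (measurable_oddsProcess hf₀ hf₁ hg n).comp measurable_snd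
  have hΓ : Measurable (Prod.fst : ℕ × (ℕ → E) → ℕ) := measurable_fst
  have hmain := tendsto_lintegral_firstPassage_sub (P := P) (R := R) (Γ := Prod.fst) hRm
    (fun ω n => oddsProcess_nonneg hf₀ hf₁ hg hρ hρ1 hr₀ _ _) hΓ (growthRate_pos hρ hρ1)
    (ae_jointLaw_of_forall hf₀ hf₁ fun k =>
      ae_tendsto_log_oddsProcess_div hf₀ hf₁ hD hg hρ hρ1 hβ hr₀ k)
    (C := 2 * ((√(1 - ρ))⁻¹ / ρ)) (by positivity) hθ hθ1 (fun x hx j hj => by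
      refine jointLaw_le_of_forall hf₀ hf₁ hπ₀ hπ₁.le hρ hρ1 ?_ fun k => ?_
      · exact measurableSet_le (measurable_from_prod_countable_right fun k =>
          measurable_oddsProcess hf₀ hf₁ hg (k + j)) measurable_const
      -- Time `Γ + j` is `j + 1` steps past coordinate `k - 1` if `k ≥ 1`, and `j` steps past it if
      -- `k = 0`.
      · obtain ⟨i, hij, hi⟩ : ∃ i, j ≤ i ∧ k + j = k - 1 + i :=
          ⟨k + j - (k - 1), by omega, by omega⟩
        have := changeLaw_oddsProcess_le_le hf₀ hf₁ hac hg hρ hρ1 hr₀ k i hx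
        rw [← hi] at this
        refine this.trans (ENNReal.ofReal_le_ofReal ?_)
        have := pow_le_pow_of_le_one hθ.le hθ1.le hij
        gcongr)
  have hset : ∀ a, {ω : ℕ × (ℕ → E) | (ω.1 : ℕ∞) ≤
      stopTime f₀ f₁ ρ (Real.sigmoid a) B π₀ ω.2} =
      {ω | (ω.1 : ℕ∞) ≤ firstPassage (R ω) (Real.exp a)} := fun a => by
    simp only [hR, stopTime_eq_firstPassage hf₀.nonneg hf₁.nonneg hρ hρ1 hB hπ₀ hπ₁]
  have hsm := fun a : ℝ => measurableSet_le_firstPassage hRm hΓ (Real.exp a)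
  -- For a fixed outcome, `exp a` eventually exceeds the finitely many odds up to time `Γ`, so the
  -- stopping time is at least `Γ`.
  have hprob : Tendsto (fun a : ℝ => P {ω | (ω.1 : ℕ∞) ≤ firstPassage (R ω) (Real.exp a)}) atTop
      (𝓝 (P Set.univ)) := by
    refine tendsto_measure_of_tendsto_indicator_of_isFiniteMeasure atTop P hsm fun ω => ?_
    have : ∀ᶠ a : ℝ in atTop, ∀ k ∈ Finset.range (ω.1 + 1), R ω k ≤ Real.exp a :=
      (Finset.eventually_all _).2 fun k _ => Real.tendsto_exp_atTop.eventually_ge_atTop _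
    filter_upwards [this] with a ha
    refine iff_of_true (natCast_lt_firstPassage_iff.2 fun k _ hk => ha k ?_).le trivial
    exact Finset.mem_range.2 (by omega)
  rw [measure_univ] at hprob
  -- Off the conditioning event the truncated difference `τ - Γ` is zero, so the conditional mean is
  -- the full integral divided by the probability of the event.
  have hcond : ∀ a, condDelay ν f₀ f₁ π₀ ρ (Real.sigmoid a) B =
      (P {ω | (ω.1 : ℕ∞) ≤ firstPassage (R ω) (Real.exp a)})⁻¹ *
        ∫⁻ ω, ((firstPassage (R ω) (Real.exp a) - ω.1 : ℕ∞) : ℝ≥0∞) ∂P := fun a => by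
    rw [condDelay, hset, ProbabilityTheory.cond, lintegral_smul_measure, smul_eq_mul,
      ← lintegral_indicator (hsm a)]
    congr 1
    refine lintegral_congr fun ω => ?_
    simp only [stopTime_eq_firstPassage hf₀.nonneg hf₁.nonneg hρ hρ1 hB hπ₀ hπ₁]
    rw [Set.indicator_apply_eq_self]
    intro hω
    have : firstPassage (R ω) (Real.exp a) ≤ ω.1 := (not_le.1 hω).le
    change ((firstPassage (R ω) (Real.exp a) - ω.1 : ℕ∞) : ℝ≥0∞) = 0
    rw [tsub_eq_zero_of_le this, ENat.toENNReal_zero]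
  have hlim := ENNReal.Tendsto.mul (tendsto_inv_iff.2 hprob) (Or.inr (by simp)) hmain
    (Or.inr (by simp))
  rw [inv_one, one_mul] at hlim
  refine hlim.congr fun a => ?_
  rw [hcond, mul_div_assoc]

/-- First-order asymptotics of the average passage time of the process with resets. -/
theorem tendsto_resetDelay_div [SigmaFinite ν] (hf₀ : IsProbDensity ν f₀) (hf₁ : IsProbDensity ν f₁)
    (hD : divergence ν f₁ f₀ ≠ ∞) (hρ : 0 < ρ) (hρ1 : ρ < 1) (b : ℝ) :
    Tendsto (fun a : ℝ => resetDelay ν f₀ f₁ ρ a b / ENNReal.ofReal a) atTop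
      (𝓝 (ENNReal.ofReal ((divergence ν f₁ f₀).toReal - Real.log (1 - ρ))⁻¹)) := by
  have hac := (InformationTheory.klDiv_ne_top_iff.1 hD).1
  have := isProbabilityMeasure_changeLaw hf₀ hf₁ 1
  set B := Real.sigmoid b
  have hB0 : 0 ≤ B := Real.sigmoid_nonneg b
  have hB : B < 1 := Real.sigmoid_lt_one b
  have hg := isSkipRule_min hρ hρ1 (odds B)
  have hβ := odds_nonneg hB0 hB
  obtain ⟨hθ, hθ1⟩ := sqrt_one_sub_pos_and_lt_one hρ hρ1
  have hmain := tendsto_lintegral_firstPassage_sub (P := changeLaw ν f₀ f₁ 1) (Γ := fun _ => 0)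
    (fun n => measurable_oddsProcess (r₀ := odds B) hf₀ hf₁ hg n)
    (fun ω n => oddsProcess_nonneg hf₀ hf₁ hg hρ hρ1 hβ _ _) measurable_const
    (growthRate_pos hρ hρ1)
    (ae_tendsto_log_oddsProcess_div hf₀ hf₁ hD hg hρ hρ1 hβ hβ 1)
    (C := 2 * ((√(1 - ρ))⁻¹ / ρ)) (by positivity) hθ hθ1 (fun x hx j hj =>
      changeLaw_oddsProcess_le_le hf₀ hf₁ hac hg hρ hρ1 hβ 1 j hx)
  refine hmain.congr' ?_
  filter_upwards [Real.tendsto_exp_atTop.eventually_ge_atTop ((odds B + ρ) / (1 - ρ))] with a ha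
  have hT := resetTime_eq_firstPassage hf₀.nonneg hf₁.nonneg hρ hρ1 hB0 hB ha
  simp only [B] at hT
  simp only [resetDelay, hT, Nat.cast_zero, tsub_zero, B]

theorem eventually_ne_top_of_tendsto_div {F : ℝ → ℝ≥0∞} {κ : ℝ}
    (h : Tendsto (fun a : ℝ => F a / ENNReal.ofReal a) atTop (𝓝 (ENNReal.ofReal κ))) :
    ∀ᶠ a in atTop, F a ≠ ∞ := by
  filter_upwards [h.eventually_lt_const ENNReal.ofReal_lt_top] with a ha hF
  rw [hF, ENNReal.top_div_of_ne_top ENNReal.ofReal_ne_top] at ha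
  exact lt_irrefl _ ha

theorem tendsto_toReal_div {F : ℝ → ℝ≥0∞} {κ : ℝ} (hκ : 0 ≤ κ)
    (h : Tendsto (fun a : ℝ => F a / ENNReal.ofReal a) atTop (𝓝 (ENNReal.ofReal κ))) :
    Tendsto (fun a : ℝ => (F a).toReal / a) atTop (𝓝 κ) := by
  have := (ENNReal.tendsto_toReal ENNReal.ofReal_ne_top).comp h
  rw [ENNReal.toReal_ofReal hκ] at this
  refine this.congr' ?_
  filter_upwards [eventually_ge_atTop 0] with a ha
  simp [ENNReal.toReal_div, ENNReal.toReal_ofReal ha]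

/-- Two functions with the same positive linear rate have quotient tending to `1`; the error term is
that quotient minus `1`. -/
theorem exists_isLittleO_one_eq_mul {F G : ℝ → ℝ} {κ : ℝ} (hκ : 0 < κ)
    (hF : Tendsto (fun a => F a / a) atTop (𝓝 κ)) (hG : Tendsto (fun a => G a / a) atTop (𝓝 κ)) :
    ∃ r : ℝ → ℝ, r =o[atTop] (fun _ => (1 : ℝ)) ∧ ∀ᶠ a in atTop, F a = G a * (1 + r a) := by
  refine ⟨fun a => F a / G a - 1, (isLittleO_one_iff ℝ).2 ?_, ?_⟩
  · have h := (hF.div hG hκ.ne').sub_const 1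
    rw [div_self hκ.ne', sub_self] at h
    refine h.congr' ?_
    filter_upwards [eventually_gt_atTop 0] with a ha
    simp only [Pi.div_apply]
    rw [div_div_div_cancel_right₀ ha.ne']
  · filter_upwards [hG.eventually_const_lt hκ] with a ha
    have : G a ≠ 0 := fun h => by simp [h] at ha
    field_simp
    ring

end Delay

end DataEfficientQCD

/-! ### Conclusion. -/

theorem mainTheorem3 {E : Type*} [MeasurableSpace E] (ν : Measure E) [SigmaFinite ν]
    (f₀ f₁ : E → ℝ) (hf₀ : DataEfficientQCD.IsProbDensity ν f₀)
    (hf₁ : DataEfficientQCD.IsProbDensity ν f₁)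
    (hD : DataEfficientQCD.divergence ν f₁ f₀ ≠ ∞)
    (π₀ : ℝ) (hπ₀ : 0 ≤ π₀) (hπ₀' : π₀ < 1)
    (ρ : ℝ) (hρ : 0 < ρ) (hρ' : ρ < 1) (b : ℝ) :
    (∀ᶠ a : ℝ in atTop,
        DataEfficientQCD.twoThresholdDelay ν f₀ f₁ π₀ ρ a b ≠ ∞ ∧
        DataEfficientQCD.resetDelay ν f₀ f₁ ρ a b ≠ ∞ ∧
        DataEfficientQCD.shiryaevDelay ν f₀ f₁ π₀ ρ a ≠ ∞) ∧
    (∃ r : ℝ → ℝ, r =o[atTop] (fun _ => (1 : ℝ)) ∧ ∀ᶠ a : ℝ in atTop,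
        (DataEfficientQCD.twoThresholdDelay ν f₀ f₁ π₀ ρ a b).toReal ≤
          (DataEfficientQCD.resetDelay ν f₀ f₁ ρ a b).toReal * (1 + r a)) ∧
    (∃ r : ℝ → ℝ, r =o[atTop] (fun _ => (1 : ℝ)) ∧ ∀ᶠ a : ℝ in atTop,
        (DataEfficientQCD.twoThresholdDelay ν f₀ f₁ π₀ ρ a b).toReal =
          a / ((DataEfficientQCD.divergence ν f₁ f₀).toReal + |Real.log (1 - ρ)|) * (1 + r a)) ∧
    (∃ r : ℝ → ℝ, r =o[atTop] (fun _ => (1 : ℝ)) ∧ ∀ᶠ a : ℝ in atTop,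
        (DataEfficientQCD.shiryaevDelay ν f₀ f₁ π₀ ρ a).toReal =
          a / ((DataEfficientQCD.divergence ν f₁ f₀).toReal + |Real.log (1 - ρ)|) * (1 + r a)) := by
  open DataEfficientQCD in
  have habs : |Real.log (1 - ρ)| = -Real.log (1 - ρ) :=
    abs_of_neg (Real.log_neg (by linarith) (by linarith))
  have hμ := growthRate_pos (ν := ν) (f₀ := f₀) (f₁ := f₁) hρ hρ'
  have hκ := inv_pos.2 hμ
  have h1 := tendsto_condDelay_div hf₀ hf₁ hD hπ₀ hπ₀' hρ hρ' (Real.sigmoid_nonneg b)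
    (Real.sigmoid_lt_one b)
  have h2 := tendsto_resetDelay_div hf₀ hf₁ hD hρ hρ' b
  -- The Shiryaev procedure is the case `B = 0`: nonnegative odds are never below level `0`, so
  -- nothing is skipped.
  have h3 := tendsto_condDelay_div hf₀ hf₁ hD hπ₀ hπ₀' hρ hρ' le_rfl zero_lt_one
  rw [habs, ← sub_eq_add_neg]
  have h4 : Tendsto (fun a : ℝ =>
      a / ((divergence ν f₁ f₀).toReal - Real.log (1 - ρ)) / a) atTop
      (𝓝 ((divergence ν f₁ f₀).toReal - Real.log (1 - ρ))⁻¹) := by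
    refine tendsto_const_nhds.congr' ?_
    filter_upwards [eventually_gt_atTop 0] with a ha
    field_simp
  refine ⟨?_, ?_, exists_isLittleO_one_eq_mul hκ (tendsto_toReal_div hκ.le h1) h4,
    exists_isLittleO_one_eq_mul hκ (tendsto_toReal_div hκ.le h3) h4⟩
  · filter_upwards [eventually_ne_top_of_tendsto_div h1, eventually_ne_top_of_tendsto_div h2,
      eventually_ne_top_of_tendsto_div h3] with a ha1 ha2 ha3
    exact ⟨ha1, ha2, ha3⟩
  -- The inequality holds even as an equality up to `1 + o(1)`, since both sides have rate `μ⁻¹`.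
  · obtain ⟨r, hr, heq⟩ := exists_isLittleO_one_eq_mul hκ (tendsto_toReal_div hκ.le h1)
      (tendsto_toReal_div hκ.le h2)
    exact ⟨r, hr, heq.mono fun a ha => ha.le⟩
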